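/- \textbf{Noise model.} Let $d\ge 1$, $L,m,q\ge 0$ be integers and $(\Omega,\mathcal F,\mathbb P)$ a probability space. For $\ell=0,\dots,L$ and $t\in\mathbb Z$ let $\varepsilon^{(\ell)}_t$ be $d$-dimensional random vectors, independent over all pairs $(\ell,t)$, of the form $\varepsilon_t^{(\ell)}=(\Sigma_t^{(\ell)})^{1/2}u_t^{(\ell)}$ with $\Sigma_t^{(\ell)}$ symmetric positive definite and $u_t^{(\ell)}$ a mean zero random vector with independent coordinates, such that (a) $\sup_{\ell,t,\nu}\mathbb E|\varepsilon_t^{(\ell,\nu)}|^4<\infty$; (b) if $d=1$, $\inf_t \mathbb E(\varepsilon_t^{(0)})^2>0$, and if $d>1$, $\inf_t\lambda_{\min}(\Sigma^{(0)}_t)>0$; (c) every coordinate $\varepsilon_t^{(\ell,\nu)}$ has a Lebesgue density $p_t^{(\ell,\nu)}$, and for all $\ell,\nu$ there is $K$ with $\int|p_t^{(\ell,\nu)}(z+x)-p_t^{(\ell,\nu)}(z)|\,dz\le K|x|$ for all $t\ge1$, $x\in\mathbb R$. Let $C_j^{(\ell)}$ ($j\ge 0$, $0\le\ell\le L$) be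 $d\times d$ matrices whose entries are bounded in absolute value by $C\max(j,1)^{-7/2-\theta}$ for some constants $C$ and $\theta\ge 3/2$, and put $F_t^{(\ell)}=\sum_{j\ge0}C_j^{(\ell)}\varepsilon^{(\ell)}_{t-j}$. For a site $s\in[0,1]^q$ let $U_t(s)$ be the $d$-vector with coordinates $$U_t^{(\nu)}(s)=\sum_{\ell=1}^L\phi_{\nu\ell}\,w(s,r_\ell)F_t^{(\ell,\nu)}+F_t^{(0,\nu)},$$ where $\phi_{\nu\ell}\in\mathbb R$, $r_\ell\in[0,1]^q$, and $w:[0,1]^q\times[0,1]^q\to[0,1]$ is a nonincreasing function of the distance of its arguments (in some norm) with $w(u,u)=1$. Let $H=(H_1,\dots,H_d):\mathbb R^{d\times(m+1)}\to\mathbb R^d$ have coordinates that are Lipschitz with respect to the Frobenius norm, let $s_{t,i}\in[0,1]^q$ be sites (for example $s_{t,i}=s_t$ or $s_{t,i}=s_{t-i}$ for a path $(s_t)$), and put $$\epsilon_t=H(U_t(s_{t,0}),\dots,U_{t-m}(s_{t,m}))-\mathbb E\,H(U_t(s_{t,0}),\dots,U_{t-m}(s_{t,m})).$$ \textbf{Regressors.}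 Let $x_{tj}\in\mathbb R$ ($t,j\ge 1$) be a bounded array, $X_{T,p}=(x_{tj})_{1\le t\le T,\,1\le j\le p}$ with rows $x_t^\top$, and let $S$ be a set of pairs $(T,p)$ of positive integers such that for positive definite $\Sigma_p\in\mathbb R^{p\times p}$, constants $C<\infty$, $\eta\ge 0$ and a compact interval $A\subset(0,\infty)$, $$\|T^{-1}X_{T,p}^\top X_{T,p}-\Sigma_p\|_2\le C\,p^\eta/\sqrt T\quad\text{and}\quad \operatorname{spec}(T^{-1}X_{T,p}^\top X_{T,p})\subset A\qquad\text{for all }(T,p)\in S.$$ \textbf{Estimator.} Fix $\nu\in\{1,\dots,d\}$. For $(T,p)\in S$, $\beta\in\mathbb R^p$, $\lambda\ge0$ and $1\le s\le 2$ let $Y_t=x_t^\top\beta+\epsilon_t^{(\nu)}$, $1\le t\le T$, let $\hat\beta$ be any minimizer over $b\in\mathbb R^p$ of $T^{-1}\|Y-X_{T,p}b\|_2^2+\lambda\|b\|_s$, where $\|b\|_s=(\sum_j|b_j|^s)^{1/s}$, and let $\widehat{\mathrm{MSPE}}=T^{-1}\sum_{t=1}^T(x_t^\top\hat\beta-x_t^\top\beta)^2$.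 Put $\lambda_{T,p}(\alpha)=(C_\nu/\alpha)^{1/2}\sqrt{p/T}$. \textbf{Theorem.} There is a constant $C_0>0$, not depending on $\alpha,s,T,p,\beta$, such that for every $C_\nu\ge C_0$ the following hold. (1) $\mathbb E\bigl|\sum_{t=1}^N x_{tj}\epsilon_t^{(\nu)}\bigr|^2\le C_\nu N$ for all $N\ge 0$ and $j\ge 1$. (2) For all $\alpha\in(0,1)$, $1\le s\le2$, $(T,p)\in S$ and $\beta\in\mathbb R^p$, the choice $\lambda=\lambda_{T,p}(\alpha)$ ensures that with probability at least $1-\alpha$ $$\widehat{\mathrm{MSPE}}\le 2\,(C_\nu/\alpha)^{1/2}\sqrt{p/T}\,\|\beta\|_s .$$ (3) Let $\alpha\in(0,1)$, $1\le s\le 2$, $(T_n,p_n)\in S$ with $T_n\to\infty$, $\beta_n\in\mathbb R^{p_n}$, and $\lambda_n=\lambda_{T_n,p_n}(\alpha)$. If $p_n=o(T_n)$ and $\|\beta_n\|_s=O(1)$, then $\widehat{\mathrm{MSPE}}\to0$ in probability as $n\to\infty$. (4) Let $\alpha_n\in(0,1)$ (for instance constant), $1\le s\le 2$, $(T_n,p_n)\in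 S$ with $T_n\to\infty$ and $p_n\to\infty$, $\beta_n\in\mathbb R^{p_n}$, and $\lambda_n=\lambda_{T_n,p_n}(\alpha_n)$. If $\|\beta_n\|_s=o\bigl(\lambda_n^{-1}\bigr)$, then $\widehat{\mathrm{MSPE}}\to0$ in probability as $n\to\infty$. -/

import Mathlib

open MeasureTheory ProbabilityTheory Filter Matrix
open scoped ENNReal Topology

noncomputable section

/-- Data of the spatial-temporal noise model. The index `0 : Fin (L + 1)` is the idiosyncratic noise,
`ℓ.succ` is the `ℓ`-th factor. -/
structure ErrorModel (d L m q : ℕ) (Ω : Type*) where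
  /-- `innov ℓ t` is the `d`-dimensional innovation of the `ℓ`-th linear process at time `t`. -/
  innov : Fin (L + 1) → ℤ → Ω → Fin d → ℝ
  /-- `coef ℓ j` is the coefficient matrix of lag `j` of the `ℓ`-th linear process. -/
  coef : Fin (L + 1) → ℕ → Matrix (Fin d) (Fin d) ℝ
  /-- factor loadings -/
  load : Fin d → Fin L → ℝ
  /-- `weight s r` is the effect at the site `s` of a factor located at `r`. -/
  weight : (Fin q → ℝ) → (Fin q → ℝ) → ℝ
  /-- the sites of the factors -/
  source : Fin L → Fin q → ℝ
  /-- `pos t i` is the site at which the `i`-th lag entering the error at time `t` is observed: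
  `pos t i = s t` when the error field is sampled at `s t`, and `pos t i = s (t - i)` when each lag
  is taken at the site visited at its own time. -/
  pos : ℤ → Fin (m + 1) → Fin q → ℝ
  /-- the nonlinearity, a function of `m + 1` consecutive `d`-vectors -/
  H : (Fin (m + 1) → Fin d → ℝ) → Fin d → ℝ

namespace ErrorModel

variable {d L m q : ℕ} {Ω : Type*}

/-- The linear process `∑_{j ≥ 0} C_j ε_{t-j}` of the `ℓ`-th source, coordinate `ν`. -/
def linProc (M : ErrorModel d L m q Ω) (ℓ : Fin (L + 1)) (t : ℤ) (ω : Ω) (ν : Fin d) : ℝ :=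
  ∑' j : ℕ, (M.coef ℓ j *ᵥ M.innov ℓ (t - j) ω) ν

/-- The linear factor field `U_t(s)`. -/
def field (M : ErrorModel d L m q Ω) (s : Fin q → ℝ) (t : ℤ) (ω : Ω) (ν : Fin d) : ℝ :=
  ∑ ℓ : Fin L, M.load ν ℓ * M.weight s (M.source ℓ) * M.linProc ℓ.succ t ω ν + M.linProc 0 t ω ν

/-- The tuple `(U_t, U_{t-1}, …, U_{t-m})` observed at time `t`. -/
def lagged (M : ErrorModel d L m q Ω) (t : ℤ) (ω : Ω) : Fin (m + 1) → Fin d → ℝ :=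
  fun i => M.field (M.pos t i) (t - (i : ℕ)) ω

variable [MeasurableSpace Ω]

/-- The error term: the centred nonlinear transform of the observed field. -/
def err (M : ErrorModel d L m q Ω) (μ : Measure Ω) (t : ℤ) (ω : Ω) (ν : Fin d) : ℝ :=
  M.H (M.lagged t ω) ν - ∫ ω', M.H (M.lagged t ω') ν ∂μ

/-- The innovations are symmetric square roots of positive definite matrices applied to mean zero
vectors with independent coordinates, and the idiosyncratic innovations are non-degenerate. -/
def InnovationStructure (M : ErrorModel d L m q Ω) (μ : Measure Ω) : Prop :=
  ∃ (Sig R : Fin (L + 1) → ℤ → Matrix (Fin d) (Fin d) ℝ) (u : Fin (L + 1) → ℤ → Ω → Fin d → ℝ),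
    (∀ ℓ t, (Sig ℓ t).PosDef ∧ (R ℓ t).PosSemidef ∧ R ℓ t * R ℓ t = Sig ℓ t) ∧
    (∀ ℓ t ω, M.innov ℓ t ω = R ℓ t *ᵥ u ℓ t ω) ∧
    (∀ ℓ t ν, Measurable (fun ω => u ℓ t ω ν)) ∧
    (∀ ℓ t ν, Integrable (fun ω => u ℓ t ω ν) μ ∧ ∫ ω, u ℓ t ω ν ∂μ = 0) ∧
    (∀ ℓ t, iIndepFun (fun (ν : Fin d) ω => u ℓ t ω ν) μ) ∧
    (d = 1 → ∃ σ : ℝ, 0 < σ ∧ ∀ t ν, σ ^ 2 ≤ ∫ ω, (M.innov 0 t ω ν) ^ 2 ∂μ) ∧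
    (1 < d → ∃ lamMin : ℝ, 0 < lamMin ∧ ∀ t, ∀ κ ∈ spectrum ℝ (Sig 0 t), lamMin ≤ κ)

/-- All innovation coordinates have densities whose `L¹`-modulus of continuity is `O(|x|)`,
uniformly over the times `t ≥ 1`. -/
def InnovationDensities (M : ErrorModel d L m q Ω) (μ : Measure Ω) : Prop :=
  ∀ ℓ ν, ∃ f : ℤ → ℝ → ℝ,
    (∀ t, Measurable (f t) ∧ (∀ z, 0 ≤ f t z) ∧
      μ.map (fun ω => M.innov ℓ t ω ν) = volume.withDensity (fun z => ENNReal.ofReal (f t z))) ∧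
    ∃ K : ℝ, ∀ t : ℤ, 1 ≤ t → ∀ x : ℝ,
      ∫⁻ z, ‖f t (z + x) - f t z‖ₑ ≤ ENNReal.ofReal (K * |x|)

/-- The weight is a nonincreasing function of the distance (with respect to some norm) of two sites
of the unit cube, has values in the unit interval and equals `1` on the diagonal. -/
def WeightAssumption (M : ErrorModel d L m q Ω) : Prop :=
  (∀ u ∈ Set.Icc (0 : Fin q → ℝ) 1, ∀ v ∈ Set.Icc (0 : Fin q → ℝ) 1,
    M.weight u v ∈ Set.Icc (0 : ℝ) 1) ∧
  (∀ u ∈ Set.Icc (0 : Fin q → ℝ) 1, M.weight u u = 1) ∧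
  ∃ N : Seminorm ℝ (Fin q → ℝ), (∀ z, N z = 0 → z = 0) ∧
    ∀ u ∈ Set.Icc (0 : Fin q → ℝ) 1, ∀ v ∈ Set.Icc (0 : Fin q → ℝ) 1,
    ∀ u' ∈ Set.Icc (0 : Fin q → ℝ) 1, ∀ v' ∈ Set.Icc (0 : Fin q → ℝ) 1,
      N (u - v) ≤ N (u' - v') → M.weight u' v' ≤ M.weight u v

/-- The assumptions on the error process: fourth moments and algebraic decay of the coefficients. -/
structure Assumptions (M : ErrorModel d L m q Ω) (μ : Measure Ω) : Prop where
  measurable_innov : ∀ ℓ t, Measurable (M.innov ℓ t)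
  /-- independent sequences of independent random vectors -/
  indep : iIndepFun (fun (k : Fin (L + 1) × ℤ) => M.innov k.1 k.2) μ
  innovation : M.InnovationStructure μ
  fourth_moment : ∃ K : ℝ, ∀ ℓ t ν, ∫⁻ ω, ‖M.innov ℓ t ω ν‖ₑ ^ 4 ∂μ ≤ ENNReal.ofReal K
  densities : M.InnovationDensities μ
  decay : ∃ C θ : ℝ, 3 / 2 ≤ θ ∧ ∀ ℓ (j : ℕ) ν k,
    |M.coef ℓ j ν k| ≤ C * (max (j : ℝ) 1) ^ (-(7 / 2 : ℝ) - θ)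
  weight_ok : M.WeightAssumption
  source_mem : ∀ ℓ, M.source ℓ ∈ Set.Icc (0 : Fin q → ℝ) 1
  pos_mem : ∀ t i, M.pos t i ∈ Set.Icc (0 : Fin q → ℝ) 1
  lipschitz : ∃ LH : ℝ, ∀ (ν : Fin d) (y z : Fin (m + 1) → Fin d → ℝ),
    |M.H y ν - M.H z ν| ≤ LH * √(∑ i, ∑ k, (y i k - z i k) ^ 2)

end ErrorModel

/-- The design matrix with rows `x_1, …, x_T`; the columns are numbered `0, …, p - 1`. -/
def designMatrix (x : ℕ → ℕ → ℝ) (T p : ℕ) : Matrix (Fin T) (Fin p) ℝ :=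
  fun t j => x (t + 1) j

/-- The Gram matrix `T⁻¹ Xᵀ X = T⁻¹ ∑ₜ xₜ xₜᵀ`. -/
def gramMatrix (x : ℕ → ℕ → ℝ) (T p : ℕ) : Matrix (Fin p) (Fin p) ℝ :=
  (T : ℝ)⁻¹ • ((designMatrix x T p)ᵀ * designMatrix x T p)

/-- The assumption on the regressors over a set `S` of pairs `(T, p)` of sample size and dimension:
bounded regressors, approximation of positive definite matrices by the Gram matrices in the spectral
norm at the rate `p ^ η / √T`, and spectra of the Gram matrices in a compact subinterval
of `(0, ∞)`. -/
structure RegressorAssumptions (x : ℕ → ℕ → ℝ) (S : Set (ℕ × ℕ)) : Prop where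
  pos : ∀ T p, (T, p) ∈ S → 1 ≤ T ∧ 1 ≤ p
  bounded : ∃ B : ℝ, ∀ t j, |x t j| ≤ B
  gram : ∃ (Sig : ∀ p : ℕ, Matrix (Fin p) (Fin p) ℝ) (C η : ℝ),
    (∀ p, (Sig p).PosDef) ∧ 0 ≤ η ∧ ∀ T p, (T, p) ∈ S →
      ‖Matrix.toEuclideanCLM (𝕜 := ℝ) (gramMatrix x T p - Sig p)‖ ≤ C * ((p : ℝ) ^ η / √(T : ℝ))
  spec : ∃ a b : ℝ, 0 < a ∧ ∀ T p, (T, p) ∈ S → spectrum ℝ (gramMatrix x T p) ⊆ Set.Icc a b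

/-- The `ℓ_s` norm on `ℝᵖ`. -/
def lsNorm (s : ℝ) {p : ℕ} (b : Fin p → ℝ) : ℝ := (∑ j, |b j| ^ s) ^ (1 / s)

/-- The penalized least squares criterion `T⁻¹ ‖Y - X b‖₂² + lam ‖b‖_s`. -/
def lsCriterion {T p : ℕ} (X : Matrix (Fin T) (Fin p) ℝ) (Y : Fin T → ℝ) (lam s : ℝ)
    (b : Fin p → ℝ) : ℝ :=
  (T : ℝ)⁻¹ * ∑ t, (Y t - (X *ᵥ b) t) ^ 2 + lam * lsNorm s b

/-- The responses `Y_t = x_tᵀ β + ε_t`, `t = 1, …, T`, for the noise sequence `e`. -/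
def response (x : ℕ → ℕ → ℝ) (T p : ℕ) (β : Fin p → ℝ) (e : ℤ → ℝ) : Fin T → ℝ :=
  fun t => (designMatrix x T p *ᵥ β) t + e ((t : ℕ) + 1)

/-- `bhat` is an `ℓ_s`-penalized least squares estimator with regularization parameter `lam` based on
the regressors `x_1, …, x_T`, the true parameter `β` and the noise `e`. -/
def IsPenalizedLSE {Ω : Type*} (x : ℕ → ℕ → ℝ) (T p : ℕ) (β : Fin p → ℝ) (e : ℤ → Ω → ℝ)
    (lam s : ℝ) (bhat : Ω → Fin p → ℝ) : Prop :=
  ∀ ω, IsMinOn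
    (lsCriterion (designMatrix x T p) (response x T p β (fun t => e t ω)) lam s) Set.univ (bhat ω)

/-- The sample mean-square prediction error `T⁻¹ ∑ₜ (x_tᵀ b - x_tᵀ β)²`. -/
def sampleMSPE (x : ℕ → ℕ → ℝ) (T p : ℕ) (β b : Fin p → ℝ) : ℝ :=
  (T : ℝ)⁻¹ * ∑ t, ((designMatrix x T p *ᵥ b) t - (designMatrix x T p *ᵥ β) t) ^ 2

/-- The regularization parameter `(C / α)^{1/2} (p / T)^{1/2}`. -/
def regParam (C α : ℝ) (T p : ℕ) : ℝ := √(C / α) * √((p : ℝ) / (T : ℝ))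

end

/-! ### The penalized least squares estimator -/

/-! Write `Q = ‖Xᵀe‖₂²` for the squared norm of the score. Comparing the criterion at `b` and at `β`
gives `MSPE ≤ (2/T) ⟨Xᵀe, b - β⟩ + lam (‖β‖_s - ‖b‖_s)`. Since `‖·‖₂ ≤ ‖·‖_s` for `s ≤ 2`,
Cauchy-Schwarz and the triangle inequality yield `MSPE ≤ 2 lam ‖β‖_s` as soon as `4Q ≤ (T lam)²`,
and for `lam = regParam C α T p` the right side is `(C/α) p T`. The estimator thus enters only
through deterministic inequalities, and everything reduces to the size of `Q`.

Second moments. The error is a Lipschitz functional of the past innovations in which lag `h` has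
weight `(h+1)⁻⁴`. Erasing the innovations up to time `s` makes the error at time `t > s` independent
of the error at time `s` and changes it by `O((t-s)⁻²)` in `L²`. Covariances are therefore summable
and the weighted partial sums have variance at most `C₁ N`, which is claim (1). Summing over the
coordinates, `E Q ≤ C₁ p T`, and Markov's inequality gives (2).

Claim (3). For fixed `α` the bound (2) leaves an exceptional set of probability `α`. Instead, a
lower bound `a` on the spectrum of the Gram matrix lets half of the prediction error absorb the
noise term: `MSPE ≤ 4Q/(aT²) + 2 lam ‖β‖_s` without any condition on `lam`, and `E Q/T² = O(p/T)`.

Claim (4). Here `p/T` need not vanish, so `Q = O(pT)` is needed with probability tending to one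
(`exists_meas_le_scoreSq_le`). Replace the error by a bounded `k`-dependent one, clipping the
innovations at level `k` and forgetting all but the last `k` of them. The same covariance argument
applied to the difference bounds the variance of its sums by `C₁ N/(k+1)`; this step uses fourth
moments. For the truncated error, `Q` is a quadratic form with matrix `XXᵀ`, whose variance is
controlled by `‖XXᵀ‖_F² ≤ T² p b²` and by entries near the diagonal, of total order `T p²`
(`IsIndepField.variance_quadForm_le`). Relative to `(pT)²` this is `O(1/p + 1/T)`, and Chebyshev's
inequality concludes. -/

theorem lsNorm_nonneg (s : ℝ) {p : ℕ} (b : Fin p → ℝ) : 0 ≤ lsNorm s b :=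
  Real.rpow_nonneg (Finset.sum_nonneg fun _ _ => Real.rpow_nonneg (abs_nonneg _) _) _

theorem lsNorm_sub_le {s : ℝ} (hs : 1 ≤ s) {p : ℕ} (b c : Fin p → ℝ) :
    lsNorm s (b - c) ≤ lsNorm s b + lsNorm s c := by
  have h := Real.Lp_add_le Finset.univ b (-c) hs
  simpa [lsNorm, sub_eq_add_neg] using h

/-- With `N = ‖b‖_s`, every `|b_j| ≤ N`, so `b_j² = |b_j|^s |b_j|^(2-s) ≤ |b_j|^s N^(2-s)`, and the
sum of the right sides is `N^s N^(2-s)`. The condition `s ≤ 2` makes the exponent `2 - s`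
nonnegative. -/
theorem sum_sq_le_lsNorm_sq {s : ℝ} (hs : s ∈ Set.Icc (1 : ℝ) 2) {p : ℕ} (b : Fin p → ℝ) :
    ∑ j, b j ^ 2 ≤ lsNorm s b ^ 2 := by
  have hs0 : 0 < s := by linarith [hs.1]
  set P := ∑ j, |b j| ^ s with hP
  have hP0 : 0 ≤ P := Finset.sum_nonneg fun _ _ => Real.rpow_nonneg (abs_nonneg _) _
  have hN0 : 0 ≤ lsNorm s b := lsNorm_nonneg s b
  have hNs : lsNorm s b ^ s = P := by
    rw [lsNorm, ← Real.rpow_mul hP0, one_div, inv_mul_cancel₀ hs0.ne', Real.rpow_one]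
  have hle : ∀ j, |b j| ≤ lsNorm s b := fun j => by
    rw [← Real.rpow_le_rpow_iff (abs_nonneg _) hN0 hs0, hNs]
    exact Finset.single_le_sum (f := fun j => |b j| ^ s)
      (fun _ _ => Real.rpow_nonneg (abs_nonneg _) _) (Finset.mem_univ j)
  have key : ∀ u : ℝ, 0 ≤ u → u ^ 2 = u ^ s * u ^ (2 - s) := fun u hu => by
    rw [← Real.rpow_add_of_nonneg hu hs0.le (by linarith [hs.2])]
    norm_num
  calc ∑ j, b j ^ 2 = ∑ j, |b j| ^ s * |b j| ^ (2 - s) := by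
        refine Finset.sum_congr rfl fun j _ => ?_
        rw [← sq_abs, key _ (abs_nonneg _)]
    _ ≤ ∑ j, |b j| ^ s * lsNorm s b ^ (2 - s) := by
        refine Finset.sum_le_sum fun j _ => ?_
        exact mul_le_mul_of_nonneg_left
          (Real.rpow_le_rpow (abs_nonneg _) (hle j) (by linarith [hs.2]))
          (Real.rpow_nonneg (abs_nonneg _) _)
    _ = lsNorm s b ^ 2 := by rw [← Finset.sum_mul, key _ hN0, hNs]

/-- The sum `∑ₜ x_{tj} e_t` over `1 ≤ t ≤ T`. -/
noncomputable def score (x : ℕ → ℕ → ℝ) (T : ℕ) (e : ℤ → ℝ) (j : ℕ) : ℝ :=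
  ∑ t ∈ Finset.Icc 1 T, x t j * e (t : ℤ)

/-- The squared Euclidean norm of `Xᵀ e`. -/
noncomputable def scoreSq (x : ℕ → ℕ → ℝ) (T p : ℕ) (e : ℤ → ℝ) : ℝ :=
  ∑ j ∈ Finset.range p, score x T e j ^ 2

theorem scoreSq_nonneg (x : ℕ → ℕ → ℝ) (T p : ℕ) (e : ℤ → ℝ) : 0 ≤ scoreSq x T p e :=
  Finset.sum_nonneg fun _ _ => sq_nonneg _

theorem sum_Icc_one_eq_sum_fin (T : ℕ) (f : ℕ → ℝ) :
    ∑ t ∈ Finset.Icc 1 T, f t = ∑ t : Fin T, f (t + 1) := by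
  rw [Fin.sum_univ_eq_sum_range (fun t => f (t + 1)), Finset.range_eq_Ico,
    Finset.sum_Ico_add' f 0 T 1]
  rfl

theorem score_eq (x : ℕ → ℕ → ℝ) (T p : ℕ) (e : ℤ → ℝ) (j : Fin p) :
    score x T e j = ∑ t : Fin T, designMatrix x T p t j * e ((t : ℕ) + 1) := by
  rw [score, sum_Icc_one_eq_sum_fin]
  simp [designMatrix]

theorem sum_mulVec_mul_eq (x : ℕ → ℕ → ℝ) (T p : ℕ) (e : ℤ → ℝ) (v : Fin p → ℝ) :
    ∑ t : Fin T, (designMatrix x T p *ᵥ v) t * e ((t : ℕ) + 1)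
      = ∑ j : Fin p, score x T e j * v j := by
  simp_rw [score_eq, Matrix.mulVec, dotProduct, Finset.sum_mul]
  rw [Finset.sum_comm]
  refine Finset.sum_congr rfl fun _ _ => Finset.sum_congr rfl fun _ _ => by ring

theorem sampleMSPE_eq (x : ℕ → ℕ → ℝ) (T p : ℕ) (β b : Fin p → ℝ) :
    sampleMSPE x T p β b = (T : ℝ)⁻¹ * ∑ t, ((designMatrix x T p *ᵥ (b - β)) t) ^ 2 := by
  simp [sampleMSPE, Matrix.mulVec_sub]

theorem sampleMSPE_nonneg (x : ℕ → ℕ → ℝ) (T p : ℕ) (β b : Fin p → ℝ) :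
    0 ≤ sampleMSPE x T p β b :=
  mul_nonneg (by positivity) (Finset.sum_nonneg fun _ _ => sq_nonneg _)

/-- The basic inequality for minimizers of the penalized criterion. -/
theorem sampleMSPE_le_of_isMinOn {x : ℕ → ℕ → ℝ} {T p : ℕ} {β b : Fin p → ℝ} {e : ℤ → ℝ}
    {lam s : ℝ}
    (h : IsMinOn (lsCriterion (designMatrix x T p) (response x T p β e) lam s) Set.univ b) :
    sampleMSPE x T p β b ≤ 2 * (T : ℝ)⁻¹ * ∑ j : Fin p, score x T e j * (b - β) j
      + lam * (lsNorm s β - lsNorm s b) := by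
  have h1 := h (Set.mem_univ β)
  simp only [Set.mem_ofPred_eq, lsCriterion, response] at h1
  have h2 : ∑ t : Fin T, ((designMatrix x T p *ᵥ β) t + e ((t : ℕ) + 1)
        - (designMatrix x T p *ᵥ b) t) ^ 2
      = ∑ t : Fin T, ((designMatrix x T p *ᵥ β) t + e ((t : ℕ) + 1)
        - (designMatrix x T p *ᵥ β) t) ^ 2
        - 2 * ∑ t : Fin T, (designMatrix x T p *ᵥ (b - β)) t * e ((t : ℕ) + 1)
        + ∑ t : Fin T, ((designMatrix x T p *ᵥ (b - β)) t) ^ 2 := by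
    rw [Finset.mul_sum, ← Finset.sum_sub_distrib, ← Finset.sum_add_distrib]
    refine Finset.sum_congr rfl fun t _ => ?_
    rw [Matrix.mulVec_sub, Pi.sub_apply]
    ring
  rw [h2, sum_mulVec_mul_eq] at h1
  rw [sampleMSPE_eq]
  nlinarith

theorem sum_score_mul_le (x : ℕ → ℕ → ℝ) (T p : ℕ) (e : ℤ → ℝ) (v : Fin p → ℝ) :
    ∑ j : Fin p, score x T e j * v j ≤ √(scoreSq x T p e) * √(∑ j, v j ^ 2) := by
  have h := Real.sum_mul_le_sqrt_mul_sqrt Finset.univ (fun j : Fin p => score x T e j) v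
  rwa [Fin.sum_univ_eq_sum_range (fun j => score x T e j ^ 2)] at h

/-- The prediction error is at most `2 lam ‖β‖_s` if `lam` dominates the noise. -/
theorem sampleMSPE_le_of_scoreSq_le {x : ℕ → ℕ → ℝ} {T p : ℕ} {β b : Fin p → ℝ} {e : ℤ → ℝ}
    {lam s : ℝ} (hT : 1 ≤ T) (hlam : 0 ≤ lam) (hs : s ∈ Set.Icc (1 : ℝ) 2)
    (h : IsMinOn (lsCriterion (designMatrix x T p) (response x T p β e) lam s) Set.univ b)
    (hQ : 4 * scoreSq x T p e ≤ (T * lam) ^ 2) :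
    sampleMSPE x T p β b ≤ 2 * lam * lsNorm s β := by
  have h1 := sampleMSPE_le_of_isMinOn h
  have h2 := sum_score_mul_le x T p e (b - β)
  have hT' : (0 : ℝ) < T := by exact_mod_cast hT
  have h3 : √(scoreSq x T p e) ≤ T * lam / 2 := by
    apply Real.sqrt_le_iff.2 ⟨by positivity, by nlinarith⟩
  have h4 : √(∑ j, (b - β) j ^ 2) ≤ lsNorm s b + lsNorm s β := by
    refine le_trans (Real.sqrt_le_iff.2 ⟨lsNorm_nonneg s _, sum_sq_le_lsNorm_sq hs _⟩) ?_
    exact lsNorm_sub_le hs.1 b β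
  have h5 : ∑ j : Fin p, score x T e j * (b - β) j
      ≤ T * lam / 2 * (lsNorm s b + lsNorm s β) :=
    h2.trans (mul_le_mul h3 h4 (Real.sqrt_nonneg _) (by positivity))
  have h6 : 2 * (T : ℝ)⁻¹ * ∑ j : Fin p, score x T e j * (b - β) j
      ≤ lam * (lsNorm s b + lsNorm s β) := by
    calc _ ≤ 2 * (T : ℝ)⁻¹ * (T * lam / 2 * (lsNorm s b + lsNorm s β)) :=
          mul_le_mul_of_nonneg_left h5 (by positivity)
      _ = _ := by field_simp
  linarith

/-- A bound for the prediction error that requires nothing of the regularization parameter, when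
the Gram matrix is bounded from below by `a`. -/
theorem sampleMSPE_le_of_lower_bound {x : ℕ → ℕ → ℝ} {T p : ℕ} {β b : Fin p → ℝ} {e : ℤ → ℝ}
    {lam s a : ℝ} (hT : 1 ≤ T) (hlam : 0 ≤ lam) (ha : 0 < a)
    (h : IsMinOn (lsCriterion (designMatrix x T p) (response x T p β e) lam s) Set.univ b)
    (hG : a * ∑ j, (b - β) j ^ 2 ≤ sampleMSPE x T p β b) :
    sampleMSPE x T p β b ≤ 4 * scoreSq x T p e / (a * T ^ 2) + 2 * lam * lsNorm s β := by
  have h1 := sampleMSPE_le_of_isMinOn h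
  have h2 := sum_score_mul_le x T p e (b - β)
  have hT' : (0 : ℝ) < T := by exact_mod_cast hT
  set u := √(scoreSq x T p e) with hu
  set v := √(∑ j, (b - β) j ^ 2) with hv
  have hu2 : u ^ 2 = scoreSq x T p e := Real.sq_sqrt (scoreSq_nonneg _ _ _ _)
  have hv2 : v ^ 2 = ∑ j, (b - β) j ^ 2 :=
    Real.sq_sqrt (Finset.sum_nonneg fun _ _ => sq_nonneg _)
  rw [← hv2] at hG
  -- Young's inequality, balanced so that `a v² / 2` is at most half of the prediction error by
  -- `hG`. Absorbing this half on the left doubles the remaining terms.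
  have h3 : 2 * (T : ℝ)⁻¹ * (u * v) ≤ a * v ^ 2 / 2 + 2 * u ^ 2 / (a * T ^ 2) := by
    have : a * v ^ 2 / 2 + 2 * u ^ 2 / (a * T ^ 2) - 2 * (T : ℝ)⁻¹ * (u * v)
        = (a / 2) * (v - 2 * u / (a * T)) ^ 2 := by field_simp; ring
    have : 0 ≤ (a / 2) * (v - 2 * u / (a * T)) ^ 2 := by positivity
    linarith
  have h4 : 2 * (T : ℝ)⁻¹ * ∑ j : Fin p, score x T e j * (b - β) j ≤ 2 * (T : ℝ)⁻¹ * (u * v) :=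
    mul_le_mul_of_nonneg_left h2 (by positivity)
  have h5 : 0 ≤ lam * lsNorm s b := mul_nonneg hlam (lsNorm_nonneg s b)
  have h6 : 4 * scoreSq x T p e / (a * T ^ 2) = 2 * (2 * u ^ 2 / (a * T ^ 2)) := by
    rw [hu2]; ring
  rw [h6]
  linarith

/-! ### Gram matrices -/

theorem gramMatrix_isHermitian (x : ℕ → ℕ → ℝ) (T p : ℕ) : (gramMatrix x T p).IsHermitian := by
  rw [Matrix.IsHermitian, gramMatrix, Matrix.conjTranspose_smul, Matrix.conjTranspose_mul]
  simp [Matrix.conjTranspose_eq_transpose_of_trivial]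

theorem sampleMSPE_eq_dotProduct (x : ℕ → ℕ → ℝ) (T p : ℕ) (β b : Fin p → ℝ) :
    sampleMSPE x T p β b = (b - β) ⬝ᵥ (gramMatrix x T p *ᵥ (b - β)) := by
  rw [sampleMSPE_eq, gramMatrix, Matrix.smul_mulVec, dotProduct_smul, ← Matrix.mulVec_mulVec,
    Matrix.dotProduct_mulVec, Matrix.vecMul_transpose, smul_eq_mul]
  simp [dotProduct, sq]

/-- The prediction error is the quadratic form of the Gram matrix `G` at `b - β`, and `G - a` is
positive semidefinite because its spectrum is that of `G` shifted by `-a`. -/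
theorem mul_sum_sq_le_sampleMSPE {x : ℕ → ℕ → ℝ} {T p : ℕ} {a : ℝ}
    (h : ∀ κ ∈ spectrum ℝ (gramMatrix x T p), a ≤ κ) (β b : Fin p → ℝ) :
    a * ∑ j, (b - β) j ^ 2 ≤ sampleMSPE x T p β b := by
  have hp : (gramMatrix x T p - algebraMap ℝ _ a).PosSemidef := by
    rw [Matrix.posSemidef_iff_isHermitian_and_spectrum_nonneg]
    refine ⟨(gramMatrix_isHermitian x T p).sub ?_, ?_⟩
    · simp [Matrix.IsHermitian, Matrix.algebraMap_eq_diagonal]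
    · intro κ hκ
      rw [← spectrum.sub_singleton_eq] at hκ
      obtain ⟨y, hy, z, hz, rfl⟩ := hκ
      have := h y hy
      simp at hz
      simp [hz, this]
  have h0 := hp.dotProduct_mulVec_nonneg (b - β)
  rw [Matrix.sub_mulVec, dotProduct_sub, star_trivial, ← sampleMSPE_eq_dotProduct,
    Algebra.algebraMap_eq_smul_one, Matrix.smul_mulVec, Matrix.one_mulVec, dotProduct_smul] at h0
  simp only [dotProduct, smul_eq_mul, ← sq] at h0
  linarith

/-- The squared Frobenius norm of `X Xᵀ` is at most `T² p b²`. -/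
theorem sum_sq_outerGram_le {x : ℕ → ℕ → ℝ} {T p : ℕ} {b : ℝ} (hT : 1 ≤ T)
    (h : ∀ κ ∈ spectrum ℝ (gramMatrix x T p), 0 ≤ κ ∧ κ ≤ b) :
    ∑ s ∈ Finset.Icc 1 T, ∑ t ∈ Finset.Icc 1 T, (∑ j ∈ Finset.range p, x s j * x t j) ^ 2
      ≤ (T : ℝ) ^ 2 * (p * b ^ 2) := by
  set X := designMatrix x T p with hX
  have hG := gramMatrix_isHermitian x T p
  have e1 : ∑ s ∈ Finset.Icc 1 T, ∑ t ∈ Finset.Icc 1 T,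
      (∑ j ∈ Finset.range p, x s j * x t j) ^ 2 = ((X * Xᵀ) * (X * Xᵀ)).trace := by
    simp_rw [sum_Icc_one_eq_sum_fin, ← Fin.sum_univ_eq_sum_range (fun j => x _ j * x _ j)]
    simp only [Matrix.trace, Matrix.diag, Matrix.mul_apply (M := X * Xᵀ)]
    refine Finset.sum_congr rfl fun s _ => Finset.sum_congr rfl fun t _ => ?_
    simp only [Matrix.mul_apply, hX, designMatrix, Matrix.transpose_apply, sq]
    congr 1
    exact Finset.sum_congr rfl fun _ _ => mul_comm _ _
  have hT' : (T : ℝ) ≠ 0 := by positivity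
  have e2 : Xᵀ * X = (T : ℝ) • gramMatrix x T p := by
    rw [gramMatrix, smul_smul, mul_inv_cancel₀ hT', one_smul]
  -- Cyclicity of the trace passes from the `T × T` matrix to the `p × p` Gram matrix, which has
  -- only `p` eigenvalues. This gains a factor `p` over the entrywise bound of order `T² p²`.
  have e3 : ((X * Xᵀ) * (X * Xᵀ)).trace
      = (T : ℝ) ^ 2 * (gramMatrix x T p * gramMatrix x T p).trace := by
    rw [Matrix.mul_assoc, Matrix.trace_mul_comm, Matrix.mul_assoc, Matrix.mul_assoc,
      ← Matrix.mul_assoc Xᵀ X, e2]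
    simp [sq, mul_assoc]
  have e4 : (gramMatrix x T p * gramMatrix x T p).trace = ∑ i, hG.eigenvalues i ^ 2 := by
    conv_lhs => rw [hG.spectral_theorem, ← map_mul, Unitary.conjStarAlgAut_apply,
      Matrix.trace_mul_comm, ← Matrix.mul_assoc, Unitary.coe_star_mul_self, Matrix.one_mul,
      Matrix.diagonal_mul_diagonal, Matrix.trace_diagonal]
    simp [sq]
  rw [e1, e3, e4]
  refine mul_le_mul_of_nonneg_left ?_ (by positivity)
  calc ∑ i, hG.eigenvalues i ^ 2 ≤ ∑ _i : Fin p, b ^ 2 := by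
        refine Finset.sum_le_sum fun i _ => ?_
        obtain ⟨h1, h2⟩ := h _ (hG.eigenvalues_mem_spectrum_real i)
        exact pow_le_pow_left₀ h1 h2 2
    _ = _ := by simp

/-! ### Bounded random variables and independent fields of σ-algebras -/

section IndepField

variable {Ω : Type*} {mΩ : MeasurableSpace Ω} {μ : Measure Ω}

/-- Bounded real functions that are measurable with respect to the σ-algebra `m`. -/
def IsBddMeasurable (m : MeasurableSpace Ω) (f : Ω → ℝ) : Prop :=
  Measurable[m] f ∧ ∃ R : ℝ, ∀ ω, |f ω| ≤ R

namespace IsBddMeasurable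

variable {m m' : MeasurableSpace Ω} {f g : Ω → ℝ}

theorem mono (hf : IsBddMeasurable m f) (h : m ≤ m') : IsBddMeasurable m' f :=
  ⟨hf.1.mono h le_rfl, hf.2⟩

theorem const (c : ℝ) : IsBddMeasurable m (fun _ => c) := ⟨measurable_const, |c|, fun _ => le_rfl⟩

theorem mul (hf : IsBddMeasurable m f) (hg : IsBddMeasurable m g) :
    IsBddMeasurable m (fun ω => f ω * g ω) := by
  obtain ⟨hf, R, hR⟩ := hf
  obtain ⟨hg, R', hR'⟩ := hg
  refine ⟨hf.mul hg, R * R', fun ω => ?_⟩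
  rw [abs_mul]
  exact mul_le_mul (hR ω) (hR' ω) (abs_nonneg _) ((abs_nonneg _).trans (hR ω))

theorem sub (hf : IsBddMeasurable m f) (hg : IsBddMeasurable m g) :
    IsBddMeasurable m (fun ω => f ω - g ω) := by
  obtain ⟨hf, R, hR⟩ := hf
  obtain ⟨hg, R', hR'⟩ := hg
  exact ⟨hf.sub hg, R + R', fun ω => (abs_sub _ _).trans (add_le_add (hR ω) (hR' ω))⟩

theorem add (hf : IsBddMeasurable m f) (hg : IsBddMeasurable m g) :
    IsBddMeasurable m (fun ω => f ω + g ω) := by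
  obtain ⟨hf, R, hR⟩ := hf
  obtain ⟨hg, R', hR'⟩ := hg
  exact ⟨hf.add hg, R + R', fun ω => (abs_add_le _ _).trans (add_le_add (hR ω) (hR' ω))⟩

theorem sum {ι : Type*} {s : Finset ι} {F : ι → Ω → ℝ} (h : ∀ i ∈ s, IsBddMeasurable m (F i)) :
    IsBddMeasurable m (fun ω => ∑ i ∈ s, F i ω) := by
  classical
  induction s using Finset.induction_on with
  | empty => simpa using const (m := m) 0
  | insert a s ha ih =>
    simp only [Finset.sum_insert ha]
    exact (h a (Finset.mem_insert_self a s)).add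
      (ih fun i hi => h i (Finset.mem_insert_of_mem hi))

theorem sq (hf : IsBddMeasurable m f) : IsBddMeasurable m (fun ω => f ω ^ 2) := by
  simpa only [pow_two] using hf.mul hf

theorem integrable [IsFiniteMeasure μ] (hf : IsBddMeasurable mΩ f) : Integrable f μ := by
  obtain ⟨hf, R, hR⟩ := hf
  exact Integrable.of_bound hf.aestronglyMeasurable R (ae_of_all _ hR)

end IsBddMeasurable

/-- A family of σ-algebras indexed by sets of times, independent over disjoint sets. -/
structure IsIndepField (𝓕 : Set ℤ → MeasurableSpace Ω) (μ : Measure Ω) : Prop where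
  mono : Monotone 𝓕
  le : ∀ A, 𝓕 A ≤ mΩ
  indep : ∀ A B, Disjoint A B → Indep (𝓕 A) (𝓕 B) μ

variable {𝓕 : Set ℤ → MeasurableSpace Ω}

theorem IsIndepField.integral_mul (h𝓕 : IsIndepField 𝓕 μ) {A B : Set ℤ} (hAB : Disjoint A B)
    {f g : Ω → ℝ} (hf : IsBddMeasurable (𝓕 A) f) (hg : IsBddMeasurable (𝓕 B) g) :
    ∫ ω, f ω * g ω ∂μ = (∫ ω, f ω ∂μ) * ∫ ω, g ω ∂μ := by
  have hi : IndepFun f g μ := by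
    rw [IndepFun_iff_Indep]
    exact indep_of_indep_of_le_left (indep_of_indep_of_le_right (h𝓕.indep A B hAB)
      hg.1.comap_le) hf.1.comap_le
  exact hi.integral_mul_eq_mul_integral (hf.1.mono (h𝓕.le A) le_rfl).aestronglyMeasurable
    (hg.1.mono (h𝓕.le B) le_rfl).aestronglyMeasurable

theorem disjoint_Ioc_of_lt_abs {k : ℕ} {a b : ℤ} (h : (k : ℤ) < |a - b|) :
    Disjoint (Set.Ioc (a - k) a) (Set.Ioc (b - k) b) := by
  rw [Set.disjoint_left]
  rintro z ⟨h1, h2⟩ ⟨h3, h4⟩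
  rcases lt_abs.1 h with h | h <;> omega

/-! ### Quadratic forms of bounded finitely dependent sequences -/

section QuadForm

variable [IsProbabilityMeasure μ] {k : ℕ} {e : ℤ → Ω → ℝ} {R : ℝ}

/-- Four times, no two pairs of which are linked and which do not lie in a common short interval,
have a time far from the others, or the first two are far from the last two. -/
theorem isolated_of_not_linked {K s t u v : ℤ}
    (h1 : ¬ (|s - u| ≤ K ∧ |t - v| ≤ K)) (h2 : ¬ (|s - v| ≤ K ∧ |t - u| ≤ K))
    (h3 : ¬ (|s - t| ≤ 3 * K ∧ |s - u| ≤ 3 * K ∧ |t - v| ≤ 3 * K)) :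
    (K < |s - u| ∧ K < |s - v| ∧ K < |t - u| ∧ K < |t - v|) ∨
    (K < |s - t| ∧ K < |s - u| ∧ K < |s - v|) ∨ (K < |t - s| ∧ K < |t - u| ∧ K < |t - v|) ∨
    (K < |u - s| ∧ K < |u - t| ∧ K < |u - v|) ∨ (K < |v - s| ∧ K < |v - t| ∧ K < |v - u|) := by
  -- Join two times when they are at most `K` apart. If this graph on four vertices has no isolated
  -- vertex, it is connected, with all distances at most `3K`, or it splits into two pairs: `st|uv`
  -- is the first alternative of the conclusion, and the other two pairings are excluded by `h1` and
  -- `h2`. The triangle inequalities reduce this to linear arithmetic in the six distances.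
  rw [abs_sub_comm t s, abs_sub_comm u s, abs_sub_comm u t, abs_sub_comm v s, abs_sub_comm v t,
    abs_sub_comm v u]
  have tri : ∀ a b c : ℤ, |a - c| ≤ |a - b| + |b - c| := abs_sub_le
  have t1 := tri s u t; have t2 := tri s v t; have t3 := tri s t u; have t4 := tri s v u
  have t5 := tri t u v; have t6 := tri t s v; have t7 := tri s t v; have t8 := tri t s u
  have t9 := tri t v u; have t10 := tri s u v; have t11 := tri u s v; have t12 := tri u t v
  rw [abs_sub_comm u t] at t1 t12
  rw [abs_sub_comm v t] at t2
  rw [abs_sub_comm v u] at t4 t9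
  rw [abs_sub_comm t s] at t6 t8
  rw [abs_sub_comm u s] at t11
  generalize |s - t| = a at *
  generalize |s - u| = b at *
  generalize |s - v| = c at *
  generalize |t - u| = d at *
  generalize |t - v| = f at *
  generalize |u - v| = g at *
  omega

/-- Variables at times more than `k` apart depend on disjoint windows and are independent. Hence the
covariance vanishes if `{s, t}` is far from `{u, v}`, or if one time is far from the other three, as
its centred factor then splits off. In the remaining configurations the crude bound `2 R ^ 4` is
used. -/
theorem IsIndepField.abs_cov_prod_le (h𝓕 : IsIndepField 𝓕 μ)
    (he : ∀ t, IsBddMeasurable (𝓕 (Set.Ioc (t - k) t)) (e t)) (hR : ∀ t ω, |e t ω| ≤ R)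
    (h0 : ∀ t, ∫ ω, e t ω ∂μ = 0) (s t u v : ℤ) :
    |∫ ω, (e s ω * e t ω) * (e u ω * e v ω) ∂μ
        - (∫ ω, e s ω * e t ω ∂μ) * ∫ ω, e u ω * e v ω ∂μ|
      ≤ 2 * R ^ 4 * ((if |s - u| ≤ k ∧ |t - v| ≤ k then 1 else 0)
        + (if |s - v| ≤ k ∧ |t - u| ≤ k then 1 else 0)
        + (if |s - t| ≤ 3 * (k : ℤ) ∧ |s - u| ≤ 3 * (k : ℤ) ∧ |t - v| ≤ 3 * (k : ℤ)
            then 1 else 0)) := by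
  have hR2 : ∀ a b ω, |e a ω * e b ω| ≤ R ^ 2 := fun a b ω => by
    rw [abs_mul, pow_two]
    exact mul_le_mul (hR a ω) (hR b ω) (abs_nonneg _) ((abs_nonneg _).trans (hR a ω))
  have hcrude : |∫ ω, (e s ω * e t ω) * (e u ω * e v ω) ∂μ
        - (∫ ω, e s ω * e t ω ∂μ) * ∫ ω, e u ω * e v ω ∂μ| ≤ 2 * R ^ 4 := by
    have i1 : |∫ ω, (e s ω * e t ω) * (e u ω * e v ω) ∂μ| ≤ R ^ 4 := by
      have := norm_integral_le_of_norm_le_const (μ := μ) (C := R ^ 4)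
        (f := fun ω => (e s ω * e t ω) * (e u ω * e v ω)) (ae_of_all _ fun ω => by
          rw [Real.norm_eq_abs, abs_mul, show R ^ 4 = R ^ 2 * R ^ 2 by ring]
          exact mul_le_mul (hR2 _ _ ω) (hR2 _ _ ω) (abs_nonneg _) (by positivity))
      simpa using this
    have i2 : ∀ a b, |∫ ω, e a ω * e b ω ∂μ| ≤ R ^ 2 := fun a b => by
      have := norm_integral_le_of_norm_le_const (μ := μ) (C := R ^ 2)
        (f := fun ω => e a ω * e b ω) (ae_of_all _ fun ω => hR2 a b ω)
      simpa using this
    refine (abs_sub _ _).trans ?_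
    rw [abs_mul]
    have := mul_le_mul (i2 s t) (i2 u v) (abs_nonneg _) (by positivity)
    nlinarith
  have hR4 : 0 ≤ 2 * R ^ 4 := by positivity
  by_cases c1 : |s - u| ≤ k ∧ |t - v| ≤ k
  · refine hcrude.trans (le_mul_of_one_le_right hR4 ?_)
    rw [if_pos c1]
    split_ifs <;> norm_num
  by_cases c2 : |s - v| ≤ k ∧ |t - u| ≤ k
  · refine hcrude.trans (le_mul_of_one_le_right hR4 ?_)
    rw [if_pos c2]
    split_ifs <;> norm_num
  by_cases c3 : |s - t| ≤ 3 * (k : ℤ) ∧ |s - u| ≤ 3 * (k : ℤ) ∧ |t - v| ≤ 3 * (k : ℤ)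
  · refine hcrude.trans (le_mul_of_one_le_right hR4 ?_)
    rw [if_pos c3]
    split_ifs
    norm_num
  rw [if_neg c1, if_neg c2, if_neg c3, add_zero, add_zero, mul_zero]
  refine le_of_eq (abs_eq_zero.2 ?_)
  let W : ℤ → Set ℤ := fun t => Set.Ioc (t - k) t
  have hW : ∀ {a b : ℤ}, (k : ℤ) < |a - b| → Disjoint (W a) (W b) := disjoint_Ioc_of_lt_abs
  have hl : ∀ {a} (B), IsBddMeasurable (𝓕 (W a ∪ B)) (e a) := fun B =>
    (he _).mono (h𝓕.mono Set.subset_union_left)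
  have hr : ∀ {A} (b), IsBddMeasurable (𝓕 (A ∪ W b)) (e b) := fun b =>
    (he _).mono (h𝓕.mono Set.subset_union_right)
  have h2 : ∀ a b, (k : ℤ) < |a - b| → ∫ ω, e a ω * e b ω ∂μ = 0 := fun a b h => by
    rw [h𝓕.integral_mul (hW h) (he a) (he b), h0, zero_mul]
  have h4 : ∀ a b c d, (k : ℤ) < |a - b| → (k : ℤ) < |a - c| → (k : ℤ) < |a - d| →
      ∫ ω, e a ω * (e b ω * (e c ω * e d ω)) ∂μ = 0 := fun a b c d hb hc hd => by
    rw [h𝓕.integral_mul (A := W a) (B := W b ∪ (W c ∪ W d))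
      (Set.disjoint_union_right.2 ⟨hW hb, Set.disjoint_union_right.2 ⟨hW hc, hW hd⟩⟩) (he a)
      ((hl _).mul (((hl _).mul (hr _)).mono (h𝓕.mono Set.subset_union_right))), h0, zero_mul]
  rcases isolated_of_not_linked c1 c2 c3 with ⟨i1, i2, i3, i4⟩ | ⟨i1, i2, i3⟩ | ⟨i1, i2, i3⟩ |
    ⟨i1, i2, i3⟩ | ⟨i1, i2, i3⟩
  · rw [h𝓕.integral_mul (A := W s ∪ W t) (B := W u ∪ W v) ?_ ((hl _).mul (hr _))
      ((hl _).mul (hr _)), sub_self]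
    exact Set.disjoint_union_left.2 ⟨Set.disjoint_union_right.2 ⟨hW i1, hW i2⟩,
      Set.disjoint_union_right.2 ⟨hW i3, hW i4⟩⟩
  · rw [h2 s t i1, zero_mul, sub_zero, ← h4 s t u v i1 i2 i3]
    exact integral_congr_ae (ae_of_all _ fun ω => by ring)
  · rw [h2 s t (abs_sub_comm t s ▸ i1), zero_mul, sub_zero, ← h4 t s u v i1 i2 i3]
    exact integral_congr_ae (ae_of_all _ fun ω => by ring)
  · rw [h2 u v i3, mul_zero, sub_zero, ← h4 u s t v i1 i2 i3]
    exact integral_congr_ae (ae_of_all _ fun ω => by ring)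
  · rw [h2 u v (abs_sub_comm v u ▸ i3), mul_zero, sub_zero, ← h4 v s t u i1 i2 i3]
    exact integral_congr_ae (ae_of_all _ fun ω => by ring)

/-- Schur's bound for a symmetric relation of bounded degree. -/
theorem sum_sum_ite_mul_le {ι : Type*} (S : Finset ι) (r : ι → ι → Prop) [DecidableRel r]
    (hsymm : ∀ i j, r i j → r j i) (D : ℕ) (hD : ∀ i ∈ S, (S.filter (r i)).card ≤ D)
    (a : ι → ℝ) :
    ∑ i ∈ S, ∑ j ∈ S, |a i| * |a j| * (if r i j then 1 else 0) ≤ D * ∑ i ∈ S, a i ^ 2 := by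
  have hdeg : ∑ i ∈ S, ∑ j ∈ S, a i ^ 2 * (if r i j then (1 : ℝ) else 0)
      ≤ D * ∑ i ∈ S, a i ^ 2 := by
    rw [Finset.mul_sum]
    refine Finset.sum_le_sum fun i hi => ?_
    rw [← Finset.mul_sum, Finset.sum_boole, mul_comm]
    exact mul_le_mul_of_nonneg_right (by exact_mod_cast hD i hi) (sq_nonneg _)
  have hswap : ∑ i ∈ S, ∑ j ∈ S, a j ^ 2 * (if r i j then (1 : ℝ) else 0)
      = ∑ i ∈ S, ∑ j ∈ S, a i ^ 2 * (if r i j then (1 : ℝ) else 0) := by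
    rw [Finset.sum_comm]
    refine Finset.sum_congr rfl fun i _ => Finset.sum_congr rfl fun j _ => ?_
    rw [if_congr ⟨hsymm j i, hsymm i j⟩ rfl rfl]
  have hpt : ∑ i ∈ S, ∑ j ∈ S, |a i| * |a j| * (if r i j then (1 : ℝ) else 0)
      ≤ ∑ i ∈ S, ∑ j ∈ S, (a i ^ 2 * (if r i j then (1 : ℝ) else 0)
        + a j ^ 2 * (if r i j then (1 : ℝ) else 0)) / 2 := by
    refine Finset.sum_le_sum fun i _ => Finset.sum_le_sum fun j _ => ?_
    have : |a i| * |a j| ≤ (a i ^ 2 + a j ^ 2) / 2 := by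
      nlinarith [sq_nonneg (|a i| - |a j|), sq_abs (a i), sq_abs (a j)]
    split_ifs <;> linarith
  simp_rw [← Finset.sum_div, Finset.sum_add_distrib] at hpt
  rw [hswap] at hpt
  linarith

theorem card_filter_abs_sub_le (S : Finset ℕ) (K s : ℕ) :
    (S.filter fun u : ℕ => |(s : ℤ) - u| ≤ K).card ≤ 2 * K + 1 := by
  refine (Finset.card_le_card (t := Finset.Icc (s - K) (s + K)) fun u hu => ?_).trans ?_
  · rw [Finset.mem_filter, abs_le] at hu
    rw [Finset.mem_Icc]
    omega
  · rw [Nat.card_Icc]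
    omega

theorem card_filter_prod_abs_sub_le (S : Finset ℕ) (K s t : ℕ) :
    ((S ×ˢ S).filter fun P : ℕ × ℕ => |(s : ℤ) - P.1| ≤ K ∧ |(t : ℤ) - P.2| ≤ K).card
      ≤ (2 * K + 1) ^ 2 := by
  rw [Finset.filter_product (fun u : ℕ => |(s : ℤ) - u| ≤ K) (fun u : ℕ => |(t : ℤ) - u| ≤ K),
    Finset.card_product, pow_two]
  exact Nat.mul_le_mul (card_filter_abs_sub_le S K s) (card_filter_abs_sub_le S K t)

/-- The variance of a quadratic form of a bounded centred finitely dependent sequence is bounded by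
the squared Frobenius norm and the diagonal of its matrix. -/
theorem IsIndepField.variance_quadForm_le (h𝓕 : IsIndepField 𝓕 μ)
    (he : ∀ t, IsBddMeasurable (𝓕 (Set.Ioc (t - k) t)) (e t)) (hR : ∀ t ω, |e t ω| ≤ R)
    (h0 : ∀ t, ∫ ω, e t ω ∂μ = 0) (S : Finset ℕ) (a : ℕ → ℕ → ℝ) (b : ℝ)
    (hb : ∀ s t, |a s t| ≤ b) :
    ∫ ω, (∑ P ∈ S ×ˢ S, a P.1 P.2 * (e P.1 ω * e P.2 ω - ∫ ω', e P.1 ω' * e P.2 ω' ∂μ)) ^ 2 ∂μ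
      ≤ 2 * R ^ 4 * (2 * (2 * k + 1) ^ 2 * ∑ P ∈ S ×ˢ S, a P.1 P.2 ^ 2
        + (6 * k + 1) ^ 2 * (18 * k + 1) * (S.card * b ^ 2)) := by
  have he' : ∀ t, IsBddMeasurable mΩ (e t) := fun t => (he t).mono (h𝓕.le _)
  let z : ℕ × ℕ → Ω → ℝ := fun P ω => e P.1 ω * e P.2 ω - ∫ ω', e P.1 ω' * e P.2 ω' ∂μ
  have hz : ∀ P, IsBddMeasurable mΩ (z P) := fun P =>
    ((he' _).mul (he' _)).sub (IsBddMeasurable.const _)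
  have hzz : ∀ P P' : ℕ × ℕ, ∫ ω, z P ω * z P' ω ∂μ
      = ∫ ω, (e P.1 ω * e P.2 ω) * (e P'.1 ω * e P'.2 ω) ∂μ
        - (∫ ω, e P.1 ω * e P.2 ω ∂μ) * ∫ ω, e P'.1 ω * e P'.2 ω ∂μ := fun P P' => by
    have hP := (he' P.1).mul (he' P.2)
    have hP' := (he' P'.1).mul (he' P'.2)
    simp only [z]
    generalize hm : ∫ ω, e P.1 ω * e P.2 ω ∂μ = c at *
    generalize hm' : ∫ ω, e P'.1 ω * e P'.2 ω ∂μ = c' at *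
    have : ∀ ω, (e P.1 ω * e P.2 ω - c) * (e P'.1 ω * e P'.2 ω - c')
        = (e P.1 ω * e P.2 ω) * (e P'.1 ω * e P'.2 ω) - c' * (e P.1 ω * e P.2 ω)
          - c * (e P'.1 ω * e P'.2 ω - c') := fun ω => by ring
    simp_rw [this]
    rw [integral_sub (((hP.mul hP').sub ((IsBddMeasurable.const c').mul hP)).integrable)
        ((IsBddMeasurable.const c).mul (hP'.sub (IsBddMeasurable.const c'))).integrable,
      integral_sub (hP.mul hP').integrable ((IsBddMeasurable.const c').mul hP).integrable,
      integral_const_mul, integral_const_mul,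
      integral_sub hP'.integrable (integrable_const _), hm, hm']
    simp [mul_comm]
  have hexp : ∫ ω, (∑ P ∈ S ×ˢ S, a P.1 P.2 * z P ω) ^ 2 ∂μ
      = ∑ P ∈ S ×ˢ S, ∑ P' ∈ S ×ˢ S, a P.1 P.2 * a P'.1 P'.2 * ∫ ω, z P ω * z P' ω ∂μ := by
    simp_rw [pow_two, Finset.sum_mul_sum]
    rw [integral_finsetSum _ fun P _ => (IsBddMeasurable.sum fun P' _ =>
      (((IsBddMeasurable.const (a P.1 P.2)).mul (hz P)).mul
        ((IsBddMeasurable.const (a P'.1 P'.2)).mul (hz P')))).integrable]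
    refine Finset.sum_congr rfl fun P _ => ?_
    rw [integral_finsetSum _ fun P' _ =>
      (((IsBddMeasurable.const (a P.1 P.2)).mul (hz P)).mul
        ((IsBddMeasurable.const (a P'.1 P'.2)).mul (hz P'))).integrable]
    refine Finset.sum_congr rfl fun P' _ => ?_
    rw [← integral_const_mul]
    exact integral_congr_ae (ae_of_all _ fun ω => by ring)
  let r₁ : ℕ × ℕ → ℕ × ℕ → Prop := fun P P' =>
    |(P.1 : ℤ) - P'.1| ≤ k ∧ |(P.2 : ℤ) - P'.2| ≤ k
  let r₂ : ℕ × ℕ → ℕ × ℕ → Prop := fun P P' =>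
    |(P.1 : ℤ) - P'.2| ≤ k ∧ |(P.2 : ℤ) - P'.1| ≤ k
  let r₃ : ℕ × ℕ → ℕ × ℕ → Prop := fun P P' =>
    |(P.1 : ℤ) - P'.1| ≤ (3 * k : ℕ) ∧ |(P.2 : ℤ) - P'.2| ≤ (3 * k : ℕ)
  let α : ℕ × ℕ → ℝ := fun P => a P.1 P.2
  -- In the third configuration `|s - t|`, `|s - u|` and `|t - v|` are at most `3k`, so `|u - v| ≤
  -- 9k`: both entries of the matrix lie in the band of half-width `9k` about the diagonal.
  -- Restricting to the band allows `r₃` to omit the condition on `|s - t|`.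
  let γ : ℕ × ℕ → ℝ := fun P => if |(P.1 : ℤ) - P.2| ≤ (9 * k : ℕ) then a P.1 P.2 else 0
  have hb0 : 0 ≤ b := (abs_nonneg _).trans (hb 0 0)
  have s₁ := sum_sum_ite_mul_le (S ×ˢ S) r₁
    (fun P P' h => ⟨abs_sub_comm (P.1 : ℤ) P'.1 ▸ h.1, abs_sub_comm (P.2 : ℤ) P'.2 ▸ h.2⟩)
    ((2 * k + 1) ^ 2) (fun P _ => card_filter_prod_abs_sub_le S k P.1 P.2) α
  have s₂ := sum_sum_ite_mul_le (S ×ˢ S) r₂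
    (fun P P' h => ⟨abs_sub_comm (P.2 : ℤ) P'.1 ▸ h.2, abs_sub_comm (P.1 : ℤ) P'.2 ▸ h.1⟩)
    ((2 * k + 1) ^ 2) (fun P _ => by
      -- Exchanging the two coordinates of the neighbour turns `r₂` into `r₁`.
      rw [← Finset.card_map (Equiv.prodComm ℕ ℕ).toEmbedding]
      refine (Finset.card_le_card fun Q hQ => ?_).trans
        (card_filter_prod_abs_sub_le S k P.1 P.2)
      simp only [Finset.mem_map, Finset.mem_filter, Finset.mem_product, r₂] at hQ ⊢
      obtain ⟨Q', ⟨⟨h1, h2⟩, h3⟩, rfl⟩ := hQ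
      exact ⟨⟨h2, h1⟩, h3⟩) α
  have s₃ := sum_sum_ite_mul_le (S ×ˢ S) r₃
    (fun P P' h => ⟨abs_sub_comm (P.1 : ℤ) P'.1 ▸ h.1, abs_sub_comm (P.2 : ℤ) P'.2 ▸ h.2⟩)
    ((2 * (3 * k) + 1) ^ 2) (fun P _ => card_filter_prod_abs_sub_le S (3 * k) P.1 P.2) γ
  have hγ : ∑ P ∈ S ×ˢ S, γ P ^ 2 ≤ (18 * k + 1) * (S.card * b ^ 2) := by
    calc ∑ P ∈ S ×ˢ S, γ P ^ 2
        ≤ ∑ s ∈ S, ∑ t ∈ S, (if |(s : ℤ) - t| ≤ (9 * k : ℕ) then (1 : ℝ) else 0) * b ^ 2 := by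
          rw [Finset.sum_product]
          refine Finset.sum_le_sum fun s _ => Finset.sum_le_sum fun t _ => ?_
          simp only [γ]
          split_ifs
          · rw [one_mul, ← sq_abs]
            exact pow_le_pow_left₀ (abs_nonneg _) (hb s t) 2
          · simp
      _ ≤ ∑ s ∈ S, (18 * k + 1) * b ^ 2 := by
          refine Finset.sum_le_sum fun s _ => ?_
          rw [← Finset.sum_mul, Finset.sum_boole]
          refine mul_le_mul_of_nonneg_right ?_ (sq_nonneg _)
          have h : ((S.filter fun u : ℕ => |(s : ℤ) - u| ≤ (9 * k : ℕ)).card : ℝ)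
              ≤ ((2 * (9 * k) + 1 : ℕ) : ℝ) := by
            exact_mod_cast card_filter_abs_sub_le S (9 * k) s
          refine h.trans_eq ?_
          push_cast
          ring
      _ = _ := by rw [Finset.sum_const, nsmul_eq_mul]; ring
  have hpt : ∀ P P' : ℕ × ℕ, a P.1 P.2 * a P'.1 P'.2 * ∫ ω, z P ω * z P' ω ∂μ
      ≤ 2 * R ^ 4 * (|α P| * |α P'| * (if r₁ P P' then 1 else 0)
        + |α P| * |α P'| * (if r₂ P P' then 1 else 0)
        + |γ P| * |γ P'| * (if r₃ P P' then 1 else 0)) := fun P P' => by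
    have hc := h𝓕.abs_cov_prod_le he hR h0 P.1 P.2 P'.1 P'.2
    rw [← hzz] at hc
    have h3 : |α P| * |α P'| * (if |(P.1 : ℤ) - P.2| ≤ 3 * (k : ℤ) ∧
          |(P.1 : ℤ) - P'.1| ≤ 3 * (k : ℤ) ∧ |(P.2 : ℤ) - P'.2| ≤ 3 * (k : ℤ) then (1 : ℝ) else 0)
        ≤ |γ P| * |γ P'| * (if r₃ P P' then 1 else 0) := by
      split_ifs with c1 c2 c2
      · have e1 : γ P = α P := if_pos (by push_cast; omega)
        have e2 : γ P' = α P' := if_pos (by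
          have := c1.1; have := c1.2.1; have := c1.2.2
          rw [abs_le] at *
          push_cast
          omega)
        rw [e1, e2]
      · exact absurd ⟨by push_cast; exact c1.2.1, by push_cast; exact c1.2.2⟩ c2
      · rw [mul_zero]; positivity
      · simp
    calc a P.1 P.2 * a P'.1 P'.2 * ∫ ω, z P ω * z P' ω ∂μ
        ≤ |α P| * |α P'| * |∫ ω, z P ω * z P' ω ∂μ| := by
          rw [← abs_mul, ← abs_mul]; exact le_abs_self _
      _ ≤ _ := (mul_le_mul_of_nonneg_left hc (by positivity)).trans (by
          have := mul_le_mul_of_nonneg_left h3 (by positivity : 0 ≤ 2 * R ^ 4)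
          simp only [r₁, r₂]
          linarith)
  have hsum := Finset.sum_le_sum fun P (_ : P ∈ S ×ˢ S) =>
    Finset.sum_le_sum fun P' (_ : P' ∈ S ×ˢ S) => hpt P P'
  simp_rw [← Finset.mul_sum, Finset.sum_add_distrib] at hsum
  change ∫ ω, (∑ P ∈ S ×ˢ S, a P.1 P.2 * z P ω) ^ 2 ∂μ ≤ _
  rw [hexp]
  refine hsum.trans (mul_le_mul_of_nonneg_left ?_ (by positivity))
  push_cast at s₁ s₂ s₃
  have s₄ := mul_le_mul_of_nonneg_left hγ (by positivity : (0 : ℝ) ≤ (2 * (3 * k) + 1) ^ 2)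
  simp only [α] at s₁ s₂
  have e6 : (2 * (3 * (k : ℝ)) + 1) = 6 * k + 1 := by ring
  rw [e6] at s₃ s₄
  linarith

end QuadForm

end IndepField

/-! ### Causal Lipschitz functionals of arrays -/

/-- The weight of the lag `h`. -/
noncomputable def lagWeight (h : ℕ) : ℝ := 1 / ((h : ℝ) + 1) ^ 4

theorem lagWeight_nonneg (h : ℕ) : 0 ≤ lagWeight h := by unfold lagWeight; positivity

theorem sum_one_div_sq_le (n : ℕ) :
    ∑ h ∈ Finset.range n, 1 / ((h : ℝ) + 1) ^ 2 ≤ 2 - 1 / (n : ℝ) := by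
  induction n with
  | zero => simp
  | succ n ih =>
    rw [Finset.sum_range_succ]
    -- The telescoping bound `1/(n+1)² ≤ 1/n - 1/(n+1)` fails at `n = 0`, where `1/0` is `0`.
    rcases Nat.eq_zero_or_pos n with rfl | hn
    · norm_num
    · have hn' : (0 : ℝ) < n := by exact_mod_cast hn
      have : 1 / ((n : ℝ) + 1) ^ 2 ≤ 1 / n - 1 / ((n : ℝ) + 1) := by
        rw [div_sub_div _ _ hn'.ne' (by positivity), div_le_div_iff₀ (by positivity) (by positivity)]
        nlinarith
      push_cast
      linarith

theorem sum_one_div_sq_le_two (n : ℕ) : ∑ h ∈ Finset.range n, 1 / ((h : ℝ) + 1) ^ 2 ≤ 2 := by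
  have h := sum_one_div_sq_le n
  have : (0 : ℝ) ≤ 1 / n := by positivity
  linarith

/-- Two of the four powers of `h + 1` are bounded by their value at `a`, the other two are summed.
The decay `a⁻²` of the tail is again summable, which is what the covariance bounds need. -/
theorem sum_lagWeight_tail_le (n a : ℕ) :
    ∑ h ∈ Finset.range n, (if a ≤ h then lagWeight h else 0) ≤ 2 / ((a : ℝ) + 1) ^ 2 := by
  calc ∑ h ∈ Finset.range n, (if a ≤ h then lagWeight h else 0)
      ≤ ∑ h ∈ Finset.range n, 1 / ((a : ℝ) + 1) ^ 2 * (1 / ((h : ℝ) + 1) ^ 2) := by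
        refine Finset.sum_le_sum fun h _ => ?_
        split_ifs with hah
        · have hah' : (a : ℝ) ≤ h := by exact_mod_cast hah
          rw [lagWeight, one_div_mul_one_div]
          refine one_div_le_one_div_of_le (by positivity) ?_
          calc ((a : ℝ) + 1) ^ 2 * ((h : ℝ) + 1) ^ 2 ≤ ((h : ℝ) + 1) ^ 2 * ((h : ℝ) + 1) ^ 2 := by
                gcongr
            _ = _ := by ring
        · positivity
    _ ≤ 1 / ((a : ℝ) + 1) ^ 2 * 2 := by
        rw [← Finset.mul_sum]
        exact mul_le_mul_of_nonneg_left (sum_one_div_sq_le_two n) (by positivity)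
    _ = _ := by ring

theorem sum_lagWeight_le (n : ℕ) : ∑ h ∈ Finset.range n, lagWeight h ≤ 2 := by
  simpa using sum_lagWeight_tail_le n 0

theorem summable_lagWeight : Summable lagWeight :=
  summable_of_sum_range_le lagWeight_nonneg sum_lagWeight_le

/-- Truncation at the levels `-k` and `k`. -/
noncomputable def clip (k : ℕ) (x : ℝ) : ℝ := max (-k) (min x k)

theorem clip_zero_left (x : ℝ) : clip 0 x = 0 := by simp [clip]

theorem clip_of_abs_le {k : ℕ} {x : ℝ} (h : |x| ≤ k) : clip k x = x := by
  rw [abs_le] at h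
  rw [clip, min_eq_left h.2, max_eq_right h.1]

theorem abs_clip_le (k : ℕ) (x : ℝ) : |clip k x| ≤ k := by
  have hk : (0 : ℝ) ≤ k := by positivity
  rw [clip, abs_le]
  exact ⟨le_max_left _ _, max_le (by linarith) (min_le_right _ _)⟩

theorem abs_clip_sub_clip_le {k l : ℕ} (hkl : k ≤ l) (x : ℝ) : |clip l x - clip k x| ≤ |x| := by
  have hk : (0 : ℝ) ≤ k := by positivity
  have hkl' : (k : ℝ) ≤ l := by exact_mod_cast hkl
  unfold clip
  rcases le_total x k with h1 | h1 <;> rcases le_total x l with h2 | h2 <;>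
  rcases le_total (-(k : ℝ)) x with h3 | h3 <;> rcases le_total (-(l : ℝ)) x with h4 | h4 <;>
  rcases abs_cases x with ⟨h5, h6⟩ | ⟨h5, h6⟩ <;>
  simp only [abs_le, min_def, max_def] <;> constructor <;> split_ifs <;> linarith

theorem abs_clip_le_abs (k : ℕ) (x : ℝ) : |clip k x| ≤ |x| := by
  simpa [clip_zero_left] using abs_clip_sub_clip_le (Nat.zero_le k) x

/-- The clips agree where `|x| ≤ k`; elsewhere `|x| ≤ x²/k ≤ 2x²/(k+1)`. A factor `1/(k+1)` is
bought with one more power of `x`, so that an `L²` estimate costs fourth moments. -/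
theorem abs_clip_sub_clip_le_sq {k l : ℕ} (hk : 0 < k) (hkl : k ≤ l) (x : ℝ) :
    |clip l x - clip k x| ≤ 2 / ((k : ℝ) + 1) * x ^ 2 := by
  have hk' : (1 : ℝ) ≤ k := by exact_mod_cast hk
  have hkl' : (k : ℝ) ≤ l := by exact_mod_cast hkl
  rcases le_total |x| k with h | h
  · rw [clip_of_abs_le h, clip_of_abs_le (h.trans hkl'), sub_self, abs_zero]
    positivity
  · refine (abs_clip_sub_clip_le hkl x).trans ?_
    rw [div_mul_eq_mul_div, le_div_iff₀ (by positivity), ← sq_abs x]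
    nlinarith

theorem continuous_clip (k : ℕ) : Continuous (clip k) := by unfold clip; fun_prop

theorem tendsto_clip (x : ℝ) : Tendsto (fun k => clip k x) atTop (𝓝 x) := by
  obtain ⟨n, hn⟩ := exists_nat_ge |x|
  refine tendsto_const_nhds.congr' ?_
  filter_upwards [eventually_ge_atTop n] with k hk
  exact (clip_of_abs_le (hn.trans (by exact_mod_cast hk))).symm

section Causal

variable {J : Type*}

/-- Arrays whose past at time `t` is summable against the lag weights. -/
def ArraySummable (t : ℤ) (y : J → ℤ → ℝ) : Prop :=
  ∀ j, Summable fun h : ℕ => lagWeight h * |y j (t - h)|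

theorem arraySummable_of_eq_zero {t : ℤ} {y : J → ℤ → ℝ} (n : ℕ)
    (hy : ∀ j τ, τ ≤ t - n → y j τ = 0) : ArraySummable t y := fun j =>
  summable_of_ne_finset_zero (s := Finset.range n) fun h hh => by
    rw [Finset.mem_range, not_lt] at hh
    rw [hy j _ (by omega), abs_zero, mul_zero]

variable {Ω : Type*}

/-- The array `Y`, truncated at level `k`, and set to zero up to time `s`. -/
noncomputable def truncArray (Y : J → ℤ → Ω → ℝ) (k : ℕ) (s : ℤ) (ω : Ω) : J → ℤ → ℝ :=
  fun j τ => if s < τ then clip k (Y j τ ω) else 0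

theorem truncArray_eq_zero (Y : J → ℤ → Ω → ℝ) (k : ℕ) {s τ : ℤ} (h : τ ≤ s) (ω : Ω) (j : J) :
    truncArray Y k s ω j τ = 0 := if_neg (not_lt.2 h)

theorem truncArray_zero (Y : J → ℤ → Ω → ℝ) (s : ℤ) (ω : Ω) : truncArray Y 0 s ω = 0 := by
  ext j τ
  simp [truncArray, clip_zero_left]

theorem abs_truncArray_le (Y : J → ℤ → Ω → ℝ) (k : ℕ) (s : ℤ) (ω : Ω) (j : J) (τ : ℤ) :
    |truncArray Y k s ω j τ| ≤ k := by
  unfold truncArray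
  split_ifs
  · exact abs_clip_le _ _
  · simp

/-- The functional `G` at time `t` of the truncated array. -/
noncomputable def truncEval (G : ℤ → (J → ℤ → ℝ) → ℝ) (Y : J → ℤ → Ω → ℝ) (k : ℕ) (s t : ℤ)
    (ω : Ω) : ℝ :=
  G t (truncArray Y k s ω)

variable [Fintype J]

/-- Functionals of the past that are Lipschitz with polynomially decaying weights. -/
structure IsCausalLipschitz (c : ℝ) (G : ℤ → (J → ℤ → ℝ) → ℝ) : Prop where
  nonneg : 0 ≤ c
  abs_sub_le : ∀ t y y', ArraySummable t y → ArraySummable t y' →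
    |G t y - G t y'| ≤ c * ∑' h : ℕ, lagWeight h * ∑ j, |y j (t - h) - y' j (t - h)|

theorem IsCausalLipschitz.abs_sub_le_sum {c : ℝ} {G : ℤ → (J → ℤ → ℝ) → ℝ}
    (hG : IsCausalLipschitz c G) {t : ℤ} {y y' : J → ℤ → ℝ} (n : ℕ)
    (hy : ∀ j τ, τ ≤ t - n → y j τ = 0) (hy' : ∀ j τ, τ ≤ t - n → y' j τ = 0) :
    |G t y - G t y'|
      ≤ ∑ h ∈ Finset.range n, ∑ j, c * lagWeight h * |y j (t - h) - y' j (t - h)| := by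
  refine (hG.abs_sub_le t y y' (arraySummable_of_eq_zero n hy)
    (arraySummable_of_eq_zero n hy')).trans_eq ?_
  rw [tsum_eq_sum (s := Finset.range n) fun h hh => ?_, Finset.mul_sum]
  · refine Finset.sum_congr rfl fun h _ => ?_
    rw [← mul_assoc, Finset.mul_sum]
  · rw [Finset.mem_range, not_lt] at hh
    rw [Finset.sum_eq_zero fun j _ => ?_, mul_zero]
    rw [hy j _ (by omega), hy' j _ (by omega), sub_self, abs_zero]

variable {c : ℝ} {G : ℤ → (J → ℤ → ℝ) → ℝ} {Y : J → ℤ → Ω → ℝ}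

theorem IsCausalLipschitz.abs_truncEval_sub_le (hG : IsCausalLipschitz c G) {k l n : ℕ}
    {s s' t : ℤ} (hs : t - n ≤ s) (hs' : t - n ≤ s') (ω : Ω) :
    |truncEval G Y l s t ω - truncEval G Y k s' t ω|
      ≤ ∑ h ∈ Finset.range n, ∑ j, c * lagWeight h *
        |truncArray Y l s ω j (t - h) - truncArray Y k s' ω j (t - h)| :=
  hG.abs_sub_le_sum n (fun _ _ h => truncArray_eq_zero Y l (h.trans hs) ω _)
    (fun _ _ h => truncArray_eq_zero Y k (h.trans hs') ω _)

theorem IsCausalLipschitz.abs_truncEval_sub_zero_le (hG : IsCausalLipschitz c G) (k n : ℕ)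
    {s t : ℤ} (hs : t - n ≤ s) (ω : Ω) :
    |truncEval G Y k s t ω - G t 0| ≤ 2 * (c * Fintype.card J) * k := by
  have h := hG.abs_truncEval_sub_le (k := 0) (l := k) (Y := Y) hs hs ω
  rw [truncEval, truncEval, truncArray_zero] at h
  refine h.trans ?_
  have hc := hG.nonneg
  calc _ ≤ ∑ h ∈ Finset.range n, ∑ _j : J, c * lagWeight h * k := by
        refine Finset.sum_le_sum fun h _ => Finset.sum_le_sum fun j _ => ?_
        refine mul_le_mul_of_nonneg_left ?_ (mul_nonneg hc (lagWeight_nonneg h))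
        simpa using abs_truncArray_le Y k s ω j (t - h)
    _ = (c * Fintype.card J * k) * ∑ h ∈ Finset.range n, lagWeight h := by
        rw [Finset.mul_sum]
        refine Finset.sum_congr rfl fun h _ => ?_
        rw [Finset.sum_const, Finset.card_univ, nsmul_eq_mul]
        ring
    _ ≤ (c * Fintype.card J * k) * 2 :=
        mul_le_mul_of_nonneg_left (sum_lagWeight_le n) (by positivity)
    _ = _ := by ring

/-- No measurability of `G` is assumed. On arrays supported in a finite window the Lipschitz bound
makes `G t` a continuous function of finitely many coordinates, and the truncated array is such an
array up to its values after time `t`, which the bound does not see. -/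
theorem IsCausalLipschitz.measurable_truncEval {m : MeasurableSpace Ω}
    (hG : IsCausalLipschitz c G) (k n : ℕ) {s t : ℤ} (hs : t - n ≤ s)
    (hY : ∀ j τ, τ ∈ Set.Ioc s t → Measurable[m] (Y j τ)) :
    Measurable[m] (truncEval G Y k s t) := by
  let emb : (J → ℕ → ℝ) → J → ℤ → ℝ := fun z j τ =>
    if t - n < τ ∧ τ ≤ t then z j (t - τ).toNat else 0
  have hemb0 : ∀ z j τ, τ ≤ t - n → emb z j τ = 0 := fun z j τ h => if_neg fun h' => by omega
  have hcont : Continuous fun z => G t (emb z) := by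
    rw [continuous_iff_continuousAt]
    intro z₀
    rw [ContinuousAt, tendsto_iff_dist_tendsto_zero]
    refine squeeze_zero (fun _ => dist_nonneg)
      (fun z => hG.abs_sub_le_sum n (hemb0 z) (hemb0 z₀)) ?_
    have hB : Continuous fun z => ∑ h ∈ Finset.range n, ∑ j,
        c * lagWeight h * |emb z j (t - h) - emb z₀ j (t - h)| := by
      refine continuous_finsetSum _ fun h _ => continuous_finsetSum _ fun j _ => ?_
      refine continuous_const.mul (Continuous.abs (Continuous.sub ?_ continuous_const))
      simp only [emb]
      split_ifs <;> fun_prop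
    have := hB.tendsto z₀
    simpa using this
  let z : Ω → J → ℕ → ℝ := fun ω j h => truncArray Y k s ω j (t - h)
  have heq : truncEval G Y k s t
      = fun ω => G t (emb (z ω)) := by
    funext ω
    have h := hG.abs_sub_le_sum (t := t) (y := truncArray Y k s ω)
      (y' := emb (z ω)) n
      (fun _ _ h => truncArray_eq_zero Y k (h.trans hs) ω _) (hemb0 (z ω))
    rw [Finset.sum_eq_zero fun h hh => Finset.sum_eq_zero fun j _ => ?_] at h
    · exact sub_eq_zero.1 (abs_nonpos_iff.1 h)
    · rw [Finset.mem_range] at hh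
      have : emb (z ω) j (t - h)
          = truncArray Y k s ω j (t - h) := by
        simp only [emb, z]
        rw [if_pos ⟨by omega, by omega⟩]
        congr 1
        omega
      beta_reduce
      rw [this, sub_self, abs_zero, mul_zero]
  rw [heq]
  have hz : Measurable[m] z := ?_
  · exact hcont.measurable.comp hz
  refine measurable_pi_iff.2 fun j => measurable_pi_iff.2 fun h => ?_
  simp only [z, truncArray]
  split_ifs with hsh
  · exact (continuous_clip k).measurable.comp (hY j _ ⟨hsh, by omega⟩)
  · exact measurable_const

end Causal

/-! ### Second moments of truncated functionals -/

section Moments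

variable {Ω : Type*} {mΩ : MeasurableSpace Ω} {μ : Measure Ω}

/-- Pointwise Cauchy-Schwarz with the weights `b`: `(∑ b V)² ≤ (∑ b)(∑ b V²)`. Nothing is required
of the dependence among the `V i`. -/
theorem integral_sq_le_of_abs_le_sum {ι : Type*} {I : Finset ι} {b : ι → ℝ} {V : ι → Ω → ℝ}
    {X : Ω → ℝ} {K : ℝ} (hb : ∀ i ∈ I, 0 ≤ b i) (hV : ∀ i, Integrable (fun ω => V i ω ^ 2) μ)
    (hK : ∀ i, ∫ ω, V i ω ^ 2 ∂μ ≤ K) (hX : ∀ ω, |X ω| ≤ ∑ i ∈ I, b i * V i ω) :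
    ∫ ω, X ω ^ 2 ∂μ ≤ (∑ i ∈ I, b i) ^ 2 * K := by
  have hpt : ∀ ω, X ω ^ 2 ≤ (∑ i ∈ I, b i) * ∑ i ∈ I, b i * V i ω ^ 2 := fun ω => by
    have h1 : X ω ^ 2 ≤ (∑ i ∈ I, b i * V i ω) ^ 2 := by
      rw [← sq_abs]
      exact pow_le_pow_left₀ (abs_nonneg _) (hX ω) 2
    refine h1.trans (Finset.sum_sq_le_sum_mul_sum_of_sq_le_mul I hb
      (fun i hi => mul_nonneg (hb i hi) (sq_nonneg _)) fun i _ => le_of_eq (by ring))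
  have hb0 : 0 ≤ ∑ i ∈ I, b i := Finset.sum_nonneg hb
  calc ∫ ω, X ω ^ 2 ∂μ ≤ ∫ ω, (∑ i ∈ I, b i) * ∑ i ∈ I, b i * V i ω ^ 2 ∂μ :=
        integral_mono_of_nonneg (ae_of_all _ fun _ => sq_nonneg _)
          ((integrable_finsetSum _ fun i _ => (hV i).const_mul _).const_mul _) (ae_of_all _ hpt)
    _ = (∑ i ∈ I, b i) * ∑ i ∈ I, b i * ∫ ω, V i ω ^ 2 ∂μ := by
        rw [integral_const_mul, integral_finsetSum _ fun i _ => (hV i).const_mul _]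
        simp_rw [integral_const_mul]
    _ ≤ (∑ i ∈ I, b i) * ∑ i ∈ I, b i * K :=
        mul_le_mul_of_nonneg_left (Finset.sum_le_sum fun i hi =>
          mul_le_mul_of_nonneg_left (hK i) (hb i hi)) hb0
    _ = _ := by rw [← Finset.sum_mul]; ring

/-- Integrate `|X Z| ≤ (r/2v) X² + (v/2r) Z²`, which is balanced for the given bounds `v` and `r`.
-/
theorem abs_integral_mul_le {X Z : Ω → ℝ} {v r : ℝ} (hv : 0 < v) (hr : 0 < r)
    (hX : Integrable (fun ω => X ω ^ 2) μ) (hZ : Integrable (fun ω => Z ω ^ 2) μ)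
    (hXv : ∫ ω, X ω ^ 2 ∂μ ≤ v ^ 2) (hZr : ∫ ω, Z ω ^ 2 ∂μ ≤ r ^ 2) :
    |∫ ω, X ω * Z ω ∂μ| ≤ v * r := by
  have hpt : ∀ ω, |X ω * Z ω| ≤ r / (2 * v) * X ω ^ 2 + v / (2 * r) * Z ω ^ 2 := fun ω => by
    have e : r / (2 * v) * X ω ^ 2 + v / (2 * r) * Z ω ^ 2 - |X ω| * |Z ω|
        = r / (2 * v) * (|X ω| - v / r * |Z ω|) ^ 2 := by
      rw [← sq_abs (X ω), ← sq_abs (Z ω)]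
      field_simp
      ring
    have : 0 ≤ r / (2 * v) * (|X ω| - v / r * |Z ω|) ^ 2 := by positivity
    rw [abs_mul]
    linarith
  calc |∫ ω, X ω * Z ω ∂μ| ≤ ∫ ω, |X ω * Z ω| ∂μ := abs_integral_le_integral_abs
    _ ≤ ∫ ω, (r / (2 * v) * X ω ^ 2 + v / (2 * r) * Z ω ^ 2) ∂μ :=
        integral_mono_of_nonneg (ae_of_all _ fun _ => abs_nonneg _)
          ((hX.const_mul _).add (hZ.const_mul _)) (ae_of_all _ hpt)
    _ = r / (2 * v) * ∫ ω, X ω ^ 2 ∂μ + v / (2 * r) * ∫ ω, Z ω ^ 2 ∂μ := by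
        rw [integral_add (hX.const_mul _) (hZ.const_mul _), integral_const_mul, integral_const_mul]
    _ ≤ r / (2 * v) * v ^ 2 + v / (2 * r) * r ^ 2 := by gcongr
    _ = v * r := by field_simp; ring

theorem integral_sub_mean_sq_le [IsProbabilityMeasure μ] {f : Ω → ℝ}
    (hf : IsBddMeasurable mΩ f) :
    ∫ ω, (f ω - ∫ ω', f ω' ∂μ) ^ 2 ∂μ ≤ ∫ ω, f ω ^ 2 ∂μ := by
  generalize hm : ∫ ω', f ω' ∂μ = a
  have e : ∀ ω, (f ω - a) ^ 2 = f ω ^ 2 - (2 * a * f ω - a ^ 2) := fun ω => by ring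
  simp_rw [e]
  have h1 : IsBddMeasurable mΩ fun ω => 2 * a * f ω := (IsBddMeasurable.const (2 * a)).mul hf
  rw [integral_sub hf.sq.integrable (h1.sub (IsBddMeasurable.const (a ^ 2))).integrable,
    integral_sub h1.integrable (integrable_const _), integral_const_mul, hm]
  simp only [integral_const, probReal_univ, one_smul]
  nlinarith [sq_nonneg a]

variable {J : Type*} [Fintype J]

/-- An array of random variables with uniformly bounded second and fourth moments, with the times
adapted to the field `𝓕`, and a causal Lipschitz functional of the array. The constant `Λ` bounds
the size of the functional. -/
structure IsCausalProcess (𝓕 : Set ℤ → MeasurableSpace Ω) (μ : Measure Ω)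
    (G : ℤ → (J → ℤ → ℝ) → ℝ) (Y : J → ℤ → Ω → ℝ) (c K Λ : ℝ) : Prop where
  field : IsIndepField 𝓕 μ
  lipschitz : IsCausalLipschitz c G
  measurable : ∀ j τ, Measurable[𝓕 {τ}] (Y j τ)
  integrable_sq : ∀ j τ, Integrable (fun ω => Y j τ ω ^ 2) μ
  integrable_four : ∀ j τ, Integrable (fun ω => (Y j τ ω ^ 2) ^ 2) μ
  integral_sq_le : ∀ j τ, ∫ ω, Y j τ ω ^ 2 ∂μ ≤ K
  integral_four_le : ∀ j τ, ∫ ω, (Y j τ ω ^ 2) ^ 2 ∂μ ≤ K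
  nonneg : 0 ≤ K
  pos : 0 < Λ
  const_le : (c * Fintype.card J) ^ 2 * K ≤ Λ ^ 2

namespace IsCausalProcess

variable {𝓕 : Set ℤ → MeasurableSpace Ω} {G : ℤ → (J → ℤ → ℝ) → ℝ} {Y : J → ℤ → Ω → ℝ}
  {c K Λ : ℝ}

theorem isBddMeasurable_truncEval (hP : IsCausalProcess 𝓕 μ G Y c K Λ) (k : ℕ) (s t : ℤ) :
    IsBddMeasurable (𝓕 (Set.Ioc s t)) (truncEval G Y k s t) := by
  have hs : t - ((t - s).toNat : ℤ) ≤ s := by omega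
  refine ⟨hP.lipschitz.measurable_truncEval k _ hs fun j τ hτ =>
    (hP.measurable j τ).mono (hP.field.mono (Set.singleton_subset_iff.2 hτ)) le_rfl,
    2 * (c * Fintype.card J) * k + |G t 0|, fun ω => ?_⟩
  have h := hP.lipschitz.abs_truncEval_sub_zero_le (Y := Y) k _ hs ω
  have h2 := abs_sub_abs_le_abs_sub (truncEval G Y k s t ω) (G t 0)
  linarith

theorem sum_sum_mul_const_le (hP : IsCausalProcess 𝓕 μ G Y c K Λ) (n : ℕ) (b : ℕ → ℝ)
    (hb : ∀ h, 0 ≤ b h) {B : ℝ} (hB : ∑ h ∈ Finset.range n, b h ≤ B) :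
    (∑ i ∈ Finset.range n ×ˢ (Finset.univ : Finset J), c * b i.1) ^ 2 * K ≤ (B * Λ) ^ 2 := by
  have hc := hP.lipschitz.nonneg
  have e : ∑ i ∈ Finset.range n ×ˢ (Finset.univ : Finset J), c * b i.1
      = (c * Fintype.card J) * ∑ h ∈ Finset.range n, b h := by
    rw [Finset.sum_product, Finset.mul_sum]
    refine Finset.sum_congr rfl fun h _ => ?_
    simp only [Finset.sum_const, Finset.card_univ, nsmul_eq_mul]
    ring
  have h0 : 0 ≤ ∑ h ∈ Finset.range n, b h := Finset.sum_nonneg fun h _ => hb h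
  rw [e, mul_pow, mul_right_comm, mul_comm, mul_pow B Λ]
  exact mul_le_mul (pow_le_pow_left₀ h0 hB 2) hP.const_le
    (mul_nonneg (sq_nonneg _) hP.nonneg) (sq_nonneg _)

/-- Forgetting the past up to time `s'` changes the functional at time `t` by `O((t - s')⁻²)`. -/
theorem integral_truncEval_sub_sq_le (hP : IsCausalProcess 𝓕 μ G Y c K Λ) (k : ℕ)
    {s s' t : ℤ} (hs : s ≤ s') (ht : s' ≤ t) :
    ∫ ω, (truncEval G Y k s t ω - truncEval G Y k s' t ω) ^ 2 ∂μ
      ≤ (2 / (|(t : ℝ) - s'| + 1) ^ 2 * Λ) ^ 2 := by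
  set n := (t - s).toNat with hn
  set a := (t - s').toNat with ha
  have hc := hP.lipschitz.nonneg
  have haR : (a : ℝ) = |(t : ℝ) - s'| := by
    rw [abs_of_nonneg (by rw [sub_nonneg]; exact_mod_cast ht)]
    have : (a : ℤ) = t - s' := by omega
    exact_mod_cast this
  rw [← haR]
  -- At lags below `a = t - s'` the two arrays agree, since the clipping level is the same; at the
  -- other lags the second array is zero. Only the tail of the weights remains.
  let b : ℕ → ℝ := fun h => if a ≤ h then lagWeight h else 0
  have hb : ∀ h, 0 ≤ b h := fun h => by
    simp only [b]; split_ifs; exacts [lagWeight_nonneg h, le_rfl]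
  refine (integral_sq_le_of_abs_le_sum (I := Finset.range n ×ˢ (Finset.univ : Finset J))
    (b := fun i => c * b i.1) (V := fun i ω => |Y i.2 (t - i.1) ω|) (K := K)
    (fun i _ => mul_nonneg hc (hb _)) (fun i => ?_) (fun i => ?_) (fun ω => ?_)).trans
    (hP.sum_sum_mul_const_le n b hb (sum_lagWeight_tail_le n a))
  · simpa only [sq_abs] using hP.integrable_sq _ _
  · simpa only [sq_abs] using hP.integral_sq_le _ _
  · refine (hP.lipschitz.abs_truncEval_sub_le (n := n) (by omega) (by omega) ω).trans ?_
    rw [Finset.sum_product]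
    refine Finset.sum_le_sum fun h _ => Finset.sum_le_sum fun j _ => ?_
    simp only [b, truncArray]
    by_cases hah : a ≤ h
    · rw [if_pos hah, if_neg (by omega : ¬ s' < t - h), sub_zero]
      refine mul_le_mul_of_nonneg_left ?_ (mul_nonneg hc (lagWeight_nonneg h))
      split_ifs
      · exact abs_clip_le_abs _ _
      · simp
    · rw [if_neg hah, if_pos (by omega : s' < t - h), if_pos (by omega : s < t - h)]
      simp

/-- The truncations of the functional at the levels `k ≤ l` are close in quadratic mean. -/
theorem integral_truncEval_sub_truncEval_sq_le (hP : IsCausalProcess 𝓕 μ G Y c K Λ) {k l : ℕ}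
    (hkl : k ≤ l) (t : ℤ) :
    ∫ ω, (truncEval G Y l (t - l) t ω - truncEval G Y k (t - k) t ω) ^ 2 ∂μ
      ≤ (6 / ((k : ℝ) + 1) * Λ) ^ 2 := by
  have hc := hP.lipschitz.nonneg
  -- Lags `h < k` lie in both windows and feel only the change of clipping level, at the cost
  -- `2/(k+1) * Y²`. The other lags lie in at most the longer window and cost `|Y|`. The weights add
  -- up to at most `4/(k+1) + 2/(k+1)² ≤ 6/(k+1)`.
  let b : ℕ → ℝ := fun h => if h < k then 2 / ((k : ℝ) + 1) * lagWeight h else lagWeight h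
  let V : ℕ × J → Ω → ℝ := fun i ω =>
    if i.1 < k then Y i.2 (t - i.1) ω ^ 2 else |Y i.2 (t - i.1) ω|
  have hb : ∀ h, 0 ≤ b h := fun h => by
    have := lagWeight_nonneg h
    simp only [b]; split_ifs <;> positivity
  have hbs : ∑ h ∈ Finset.range l, b h ≤ 6 / ((k : ℝ) + 1) := by
    calc ∑ h ∈ Finset.range l, b h
        ≤ ∑ h ∈ Finset.range l,
          (2 / ((k : ℝ) + 1) * lagWeight h + if k ≤ h then lagWeight h else 0) := by
          refine Finset.sum_le_sum fun h _ => ?_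
          have := lagWeight_nonneg h
          simp only [b]
          by_cases hk : h < k
          · rw [if_pos hk, if_neg (by omega), add_zero]
          · rw [if_neg hk, if_pos (by omega)]
            have : 0 ≤ 2 / ((k : ℝ) + 1) * lagWeight h := by positivity
            linarith
      _ ≤ 2 / ((k : ℝ) + 1) * 2 + 2 / ((k : ℝ) + 1) ^ 2 := by
          rw [Finset.sum_add_distrib, ← Finset.mul_sum]
          exact add_le_add (mul_le_mul_of_nonneg_left (sum_lagWeight_le l) (by positivity))
            (sum_lagWeight_tail_le l k)
      _ ≤ 2 / ((k : ℝ) + 1) * 2 + 2 / ((k : ℝ) + 1) := by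
          gcongr
          have : (0 : ℝ) ≤ k := by positivity
          nlinarith
      _ = _ := by ring
  refine (integral_sq_le_of_abs_le_sum (I := Finset.range l ×ˢ (Finset.univ : Finset J))
    (b := fun i => c * b i.1) (V := V) (K := K)
    (fun i _ => mul_nonneg hc (hb _)) (fun i => ?_) (fun i => ?_) (fun ω => ?_)).trans
    (hP.sum_sum_mul_const_le l b hb hbs)
  · by_cases hi : i.1 < k
    · simpa only [V, if_pos hi] using hP.integrable_four _ _
    · simpa only [V, if_neg hi, sq_abs] using hP.integrable_sq _ _
  · by_cases hi : i.1 < k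
    · simpa only [V, if_pos hi] using hP.integral_four_le _ _
    · simpa only [V, if_neg hi, sq_abs] using hP.integral_sq_le _ _
  · refine (hP.lipschitz.abs_truncEval_sub_le (n := l) (by omega) (by omega) ω).trans ?_
    rw [Finset.sum_product]
    refine Finset.sum_le_sum fun h hh => Finset.sum_le_sum fun j _ => ?_
    rw [Finset.mem_range] at hh
    have hw := lagWeight_nonneg h
    simp only [b, V, truncArray]
    rw [if_pos (by omega : t - (l : ℤ) < t - h)]
    by_cases hk : h < k
    · rw [if_pos hk, if_pos hk, if_pos (by omega : t - (k : ℤ) < t - h)]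
      have := mul_le_mul_of_nonneg_left
        (abs_clip_sub_clip_le_sq (by omega) hkl (Y j (t - h) ω)) (mul_nonneg hc hw)
      linarith
    · rw [if_neg hk, if_neg hk, if_neg (by omega : ¬ t - (k : ℤ) < t - h), sub_zero]
      exact mul_le_mul_of_nonneg_left (abs_clip_le_abs _ _) (mul_nonneg hc hw)

end IsCausalProcess

end Moments

/-! ### Covariances of the differences of truncated processes -/

section Limit

variable {Ω : Type*} {mΩ : MeasurableSpace Ω} {μ : Measure Ω} {J : Type*}

/-- The centred functional of the truncated array. It depends on the times `t - k < τ ≤ t` only. -/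
noncomputable def centTrunc (μ : Measure Ω) (G : ℤ → (J → ℤ → ℝ) → ℝ) (Y : J → ℤ → Ω → ℝ)
    (k : ℕ) (t : ℤ) (ω : Ω) : ℝ :=
  truncEval G Y k (t - k) t ω - ∫ ω', truncEval G Y k (t - k) t ω' ∂μ

theorem sum_one_div_abs_sub_sq_le (N s : ℕ) :
    ∑ t ∈ Finset.Icc 1 N, 1 / (|(t : ℝ) - s| + 1) ^ 2 ≤ 4 := by
  rw [← Finset.sum_filter_add_sum_filter_not _ (fun t => t ≤ s)]
  have key : ∀ (S : Finset ℕ) (f : ℕ → ℕ), Set.InjOn f S →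
      (∀ t ∈ S, |(t : ℝ) - s| = f t) → ∑ t ∈ S, 1 / (|(t : ℝ) - s| + 1) ^ 2 ≤ 2 := by
    intro S f hf hS
    rw [Finset.sum_congr rfl fun t ht => by rw [hS t ht],
      ← Finset.sum_image (f := fun h : ℕ => 1 / ((h : ℝ) + 1) ^ 2) hf]
    obtain ⟨n, hn⟩ := (S.image f).exists_nat_subset_range
    exact (Finset.sum_le_sum_of_subset_of_nonneg hn fun _ _ _ => by positivity).trans
      (sum_one_div_sq_le_two n)
  have h1 := key ((Finset.Icc 1 N).filter fun t => t ≤ s) (fun t => s - t)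
    (fun a ha b hb hab => by
      simp only [Finset.coe_filter, Set.mem_ofPred_eq] at ha hb
      simp only at hab
      omega)
    (fun t ht => by
      rw [Finset.mem_filter] at ht
      rw [Nat.cast_sub ht.2, abs_sub_comm, abs_of_nonneg]
      rw [sub_nonneg]
      exact_mod_cast ht.2)
  have h2 := key ((Finset.Icc 1 N).filter fun t => ¬ t ≤ s) (fun t => t - s)
    (fun a ha b hb hab => by
      simp only [Finset.coe_filter, Set.mem_ofPred_eq] at ha hb
      simp only at hab
      omega)
    (fun t ht => by
      rw [Finset.mem_filter, not_le] at ht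
      rw [Nat.cast_sub ht.2.le, abs_of_nonneg]
      rw [sub_nonneg]
      exact_mod_cast ht.2.le)
  linarith

variable [Fintype J]

namespace IsCausalProcess

variable {𝓕 : Set ℤ → MeasurableSpace Ω} {G : ℤ → (J → ℤ → ℝ) → ℝ} {Y : J → ℤ → Ω → ℝ}
  {c K Λ : ℝ}

theorem isBddMeasurable_centTrunc (hP : IsCausalProcess 𝓕 μ G Y c K Λ) (k : ℕ) (t : ℤ) :
    IsBddMeasurable (𝓕 (Set.Ioc (t - k) t)) (centTrunc μ G Y k t) :=
  (hP.isBddMeasurable_truncEval k (t - k) t).sub (IsBddMeasurable.const _)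

variable [IsProbabilityMeasure μ]

theorem integral_centTrunc (hP : IsCausalProcess 𝓕 μ G Y c K Λ) (k : ℕ) (t : ℤ) :
    ∫ ω, centTrunc μ G Y k t ω ∂μ = 0 := by
  unfold centTrunc
  rw [integral_sub ((hP.isBddMeasurable_truncEval k (t - k) t).mono (hP.field.le _)).integrable
    (integrable_const _)]
  simp

theorem abs_centTrunc_le (hP : IsCausalProcess 𝓕 μ G Y c K Λ) (k : ℕ) (t : ℤ) (ω : Ω) :
    |centTrunc μ G Y k t ω| ≤ 4 * (c * Fintype.card J) * k := by
  have h := fun ω => hP.lipschitz.abs_truncEval_sub_zero_le (Y := Y) k k (le_refl (t - (k : ℤ))) ω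
  have hi := ((hP.isBddMeasurable_truncEval k (t - k) t).mono (hP.field.le _)).integrable (μ := μ)
  have h2 : |∫ ω', (truncEval G Y k (t - k) t ω' - G t 0) ∂μ| ≤ 2 * (c * Fintype.card J) * k := by
    have := norm_integral_le_of_norm_le_const (μ := μ)
      (f := fun ω => truncEval G Y k (t - k) t ω - G t 0) (ae_of_all _ h)
    simpa using this
  rw [integral_sub hi (integrable_const _)] at h2
  simp only [integral_const, probReal_univ, one_smul] at h2
  have h3 := abs_sub (truncEval G Y k (t - k) t ω - G t 0)
    (∫ ω', truncEval G Y k (t - k) t ω' ∂μ - G t 0)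
  rw [sub_sub_sub_cancel_right] at h3
  have := h ω
  unfold centTrunc
  linarith

theorem integral_centTrunc_sub_sq_le (hP : IsCausalProcess 𝓕 μ G Y c K Λ) {k l : ℕ}
    (hkl : k ≤ l) (t : ℤ) :
    ∫ ω, (centTrunc μ G Y l t ω - centTrunc μ G Y k t ω) ^ 2 ∂μ ≤ (6 / ((k : ℝ) + 1) * Λ) ^ 2 := by
  have hg : ∀ k : ℕ, IsBddMeasurable mΩ (truncEval G Y k (t - k) t) := fun k =>
    (hP.isBddMeasurable_truncEval k _ t).mono (hP.field.le _)
  refine le_trans (le_of_eq ?_) ((integral_sub_mean_sq_le ((hg l).sub (hg k))).trans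
    (hP.integral_truncEval_sub_truncEval_sq_le hkl t))
  rw [integral_sub (hg l).integrable (hg k).integrable]
  refine integral_congr_ae (ae_of_all _ fun ω => ?_)
  simp only [centTrunc]
  ring

/-- The difference `D` at time `s` is a function of the past up to `s`. Erasing this past from the
functionals at time `t` leaves variables independent of the centred `D`, hence orthogonal to it.
Only the erased part contributes, of size `O((t-s)⁻²)` in `L²`, while `D` has size `6Λ/(k+1)`. -/
theorem abs_integral_centTrunc_sub_mul_le_of_lt (hP : IsCausalProcess 𝓕 μ G Y c K Λ) {k l : ℕ}
    (hkl : k ≤ l) {s t : ℤ} (hst : s < t) :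
    |∫ ω, (centTrunc μ G Y l s ω - centTrunc μ G Y k s ω)
        * (centTrunc μ G Y l t ω - centTrunc μ G Y k t ω) ∂μ|
      ≤ 36 * Λ ^ 2 / (k + 1) * (1 / (|(t : ℝ) - s| + 1) ^ 2) := by
  have hΛ := hP.pos
  let D : Ω → ℝ := fun ω => centTrunc μ G Y l s ω - centTrunc μ G Y k s ω
  let g : ℕ → Ω → ℝ := fun k => truncEval G Y k (t - k) t
  -- The window may already start after `s`; the maximum then leaves it unchanged and `g' k = g k`.
  let g' : ℕ → Ω → ℝ := fun k => truncEval G Y k (max s (t - k)) t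
  have hD : IsBddMeasurable (𝓕 (Set.Iic s)) D :=
    ((hP.isBddMeasurable_centTrunc l s).mono (hP.field.mono Set.Ioc_subset_Iic_self)).sub
      ((hP.isBddMeasurable_centTrunc k s).mono (hP.field.mono Set.Ioc_subset_Iic_self))
  have hD' : IsBddMeasurable mΩ D := hD.mono (hP.field.le _)
  have hg : ∀ k, IsBddMeasurable mΩ (g k) := fun k =>
    (hP.isBddMeasurable_truncEval k _ t).mono (hP.field.le _)
  have hg' : ∀ k, IsBddMeasurable (𝓕 (Set.Ioi s)) (g' k) := fun k =>
    (hP.isBddMeasurable_truncEval k _ t).mono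
      (hP.field.mono fun τ hτ => lt_of_le_of_lt (le_max_left _ _) hτ.1)
  have hg'' : ∀ k, IsBddMeasurable mΩ (g' k) := fun k => (hg' k).mono (hP.field.le _)
  have hD0 : ∫ ω, D ω ∂μ = 0 := by
    simp only [D]
    rw [integral_sub ((hP.isBddMeasurable_centTrunc l s).mono (hP.field.le _)).integrable
      ((hP.isBddMeasurable_centTrunc k s).mono (hP.field.le _)).integrable,
      hP.integral_centTrunc, hP.integral_centTrunc, sub_zero]
  have hDg : ∀ k, ∫ ω, D ω * g' k ω ∂μ = 0 := fun k => by
    rw [hP.field.integral_mul (Set.Iic_disjoint_Ioi le_rfl) hD (hg' k), hD0, zero_mul]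
  let Z : Ω → ℝ := fun ω => (g l ω - g' l ω) - (g k ω - g' k ω)
  have hZ : IsBddMeasurable mΩ Z :=
    ((hg l).sub (hg'' l)).sub ((hg k).sub (hg'' k))
  have heq : ∫ ω, D ω * (centTrunc μ G Y l t ω - centTrunc μ G Y k t ω) ∂μ
      = ∫ ω, D ω * Z ω ∂μ := by
    set a := ∫ ω, g l ω ∂μ with ha
    set b := ∫ ω, g k ω ∂μ with hb
    have e : ∀ ω, D ω * (centTrunc μ G Y l t ω - centTrunc μ G Y k t ω)
        = D ω * Z ω + (D ω * g' l ω - (D ω * g' k ω + (a - b) * D ω)) := fun ω => by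
      simp only [centTrunc, Z, g, ha, hb]
      ring
    simp_rw [e]
    have h1 := hD'.mul (hg'' l)
    have h2 := hD'.mul (hg'' k)
    have h3 : IsBddMeasurable mΩ fun ω => (a - b) * D ω :=
      (IsBddMeasurable.const (a - b)).mul hD'
    rw [integral_add (hD'.mul hZ).integrable (h1.sub (h2.add h3)).integrable,
      integral_sub h1.integrable (h2.add h3).integrable,
      integral_add h2.integrable h3.integrable, hDg, hDg, integral_const_mul, hD0]
    simp
  set r : ℝ := 2 / (|(t : ℝ) - s| + 1) ^ 2 * Λ with hr
  have hgr : ∀ k, ∫ ω, (g k ω - g' k ω) ^ 2 ∂μ ≤ r ^ 2 := fun k => by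
    by_cases h : s ≤ t - k
    · have : g' k = g k := by simp only [g', g, max_eq_right h]
      simp only [this, sub_self]
      simpa using sq_nonneg r
    · have := hP.integral_truncEval_sub_sq_le k (s := t - k) (s' := s) (t := t)
        (not_le.1 h).le hst.le
      simpa only [g, g', max_eq_left (not_le.1 h).le] using this
  have hZr : ∫ ω, Z ω ^ 2 ∂μ ≤ (2 * r) ^ 2 := by
    have i1 := ((hg l).sub (hg'' l)).sq
    have i2 := ((hg k).sub (hg'' k)).sq
    have h2 : ∀ k, IsBddMeasurable mΩ fun ω => 2 * (g k ω - g' k ω) ^ 2 := fun k =>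
      (IsBddMeasurable.const 2).mul ((hg k).sub (hg'' k)).sq
    calc ∫ ω, Z ω ^ 2 ∂μ ≤ ∫ ω, (2 * (g l ω - g' l ω) ^ 2 + 2 * (g k ω - g' k ω) ^ 2) ∂μ :=
          integral_mono hZ.sq.integrable ((h2 l).add (h2 k)).integrable fun ω => by
            simp only [Z]
            nlinarith [sq_nonneg ((g l ω - g' l ω) + (g k ω - g' k ω))]
      _ = 2 * ∫ ω, (g l ω - g' l ω) ^ 2 ∂μ + 2 * ∫ ω, (g k ω - g' k ω) ^ 2 ∂μ := by
          rw [integral_add (h2 l).integrable (h2 k).integrable, integral_const_mul,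
            integral_const_mul]
      _ ≤ (2 * r) ^ 2 := by nlinarith [hgr l, hgr k]
  have hDv := hP.integral_centTrunc_sub_sq_le hkl s
  have hmain := abs_integral_mul_le (v := 6 / ((k : ℝ) + 1) * Λ) (r := 2 * r)
    (by positivity) (by positivity) hD'.sq.integrable hZ.sq.integrable hDv hZr
  rw [← heq] at hmain
  refine hmain.trans ?_
  have e : 6 / ((k : ℝ) + 1) * Λ * (2 * r)
      = 24 * (Λ ^ 2 / (k + 1) * (1 / (|(t : ℝ) - s| + 1) ^ 2)) := by
    rw [hr]; ring
  have e' : 36 * Λ ^ 2 / ((k : ℝ) + 1) * (1 / (|(t : ℝ) - s| + 1) ^ 2)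
      = 36 * (Λ ^ 2 / (k + 1) * (1 / (|(t : ℝ) - s| + 1) ^ 2)) := by ring
  rw [e, e']
  have : 0 ≤ Λ ^ 2 / (k + 1) * (1 / (|(t : ℝ) - s| + 1) ^ 2) := by positivity
  linarith

/-- The constant `36` comes from the diagonal `s = t`, where `(6Λ/(k+1))²` is weakened by one factor
`k + 1`; off the diagonal `24` would do. -/
theorem abs_integral_centTrunc_sub_mul_le (hP : IsCausalProcess 𝓕 μ G Y c K Λ) {k l : ℕ}
    (hkl : k ≤ l) (s t : ℤ) :
    |∫ ω, (centTrunc μ G Y l s ω - centTrunc μ G Y k s ω)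
        * (centTrunc μ G Y l t ω - centTrunc μ G Y k t ω) ∂μ|
      ≤ 36 * Λ ^ 2 / (k + 1) * (1 / (|(t : ℝ) - s| + 1) ^ 2) := by
  rcases lt_trichotomy s t with h | rfl | h
  · exact hP.abs_integral_centTrunc_sub_mul_le_of_lt hkl h
  · have h := hP.integral_centTrunc_sub_sq_le hkl s
    simp_rw [← pow_two]
    rw [abs_of_nonneg (integral_nonneg fun _ => sq_nonneg _)]
    refine h.trans ?_
    rw [sub_self, abs_zero, zero_add, one_pow, div_one, mul_one, mul_pow, div_pow, div_mul_eq_mul_div]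
    have := hP.pos
    norm_num
    gcongr
    have : (0 : ℝ) ≤ k := by positivity
    nlinarith
  · have := hP.abs_integral_centTrunc_sub_mul_le_of_lt hkl h
    rw [abs_sub_comm]
    simpa only [mul_comm] using this

/-- The weighted sums of the differences of truncated processes have variances of linear growth. -/
theorem integral_sum_centTrunc_sub_sq_le (hP : IsCausalProcess 𝓕 μ G Y c K Λ) {k l : ℕ}
    (hkl : k ≤ l) {x : ℕ → ℝ} {B : ℝ} (hx : ∀ t, |x t| ≤ B) (N : ℕ) :
    ∫ ω, (∑ t ∈ Finset.Icc 1 N,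
        x t * (centTrunc μ G Y l (t : ℤ) ω - centTrunc μ G Y k (t : ℤ) ω)) ^ 2 ∂μ
      ≤ 144 * B ^ 2 * Λ ^ 2 / (k + 1) * N := by
  have hB0 : 0 ≤ B := (abs_nonneg _).trans (hx 0)
  have hΛ := hP.pos
  let D : ℕ → Ω → ℝ := fun t ω => centTrunc μ G Y l (t : ℤ) ω - centTrunc μ G Y k (t : ℤ) ω
  have hD : ∀ t, IsBddMeasurable mΩ (D t) := fun t =>
    ((hP.isBddMeasurable_centTrunc l t).mono (hP.field.le _)).sub
      ((hP.isBddMeasurable_centTrunc k t).mono (hP.field.le _))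
  have hDD : ∀ s t, IsBddMeasurable mΩ fun ω => x s * x t * (D s ω * D t ω) := fun s t =>
    (IsBddMeasurable.const (x s * x t)).mul ((hD s).mul (hD t))
  have e : ∀ ω, (∑ t ∈ Finset.Icc 1 N, x t * D t ω) ^ 2
      = ∑ s ∈ Finset.Icc 1 N, ∑ t ∈ Finset.Icc 1 N, x s * x t * (D s ω * D t ω) := fun ω => by
    rw [pow_two, Finset.sum_mul_sum]
    exact Finset.sum_congr rfl fun s _ => Finset.sum_congr rfl fun t _ => by ring
  change ∫ ω, (∑ t ∈ Finset.Icc 1 N, x t * D t ω) ^ 2 ∂μ ≤ _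
  simp_rw [e]
  rw [integral_finsetSum _ fun s _ => (IsBddMeasurable.sum fun t _ => hDD s t).integrable]
  calc ∑ s ∈ Finset.Icc 1 N, ∫ ω, ∑ t ∈ Finset.Icc 1 N, x s * x t * (D s ω * D t ω) ∂μ
      ≤ ∑ s ∈ Finset.Icc 1 N, 144 * B ^ 2 * Λ ^ 2 / (k + 1) := by
        refine Finset.sum_le_sum fun s _ => ?_
        rw [integral_finsetSum _ fun t _ => (hDD s t).integrable]
        calc ∑ t ∈ Finset.Icc 1 N, ∫ ω, x s * x t * (D s ω * D t ω) ∂μ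
            ≤ ∑ t ∈ Finset.Icc 1 N,
              (B * B) * (36 * Λ ^ 2 / (k + 1) * (1 / (|(t : ℝ) - s| + 1) ^ 2)) := by
              refine Finset.sum_le_sum fun t _ => ?_
              rw [integral_const_mul]
              refine (le_abs_self _).trans ?_
              rw [abs_mul, abs_mul]
              have h := hP.abs_integral_centTrunc_sub_mul_le hkl (s : ℤ) (t : ℤ)
              push_cast at h
              exact mul_le_mul (mul_le_mul (hx s) (hx t) (abs_nonneg _) hB0) h (abs_nonneg _)
                (by positivity)
          _ = (B * B) * (36 * Λ ^ 2 / (k + 1))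
              * ∑ t ∈ Finset.Icc 1 N, 1 / (|(t : ℝ) - s| + 1) ^ 2 := by
              rw [Finset.mul_sum]
              exact Finset.sum_congr rfl fun t _ => by ring
          -- The inverse squares on each side of `s` sum to at most `2`, whence `4` and the constant
          -- `144 = 4 * 36`.
          _ ≤ (B * B) * (36 * Λ ^ 2 / (k + 1)) * 4 :=
              mul_le_mul_of_nonneg_left (sum_one_div_abs_sub_sq_le N s) (by positivity)
          _ = _ := by ring
    _ = _ := by
        rw [Finset.sum_const, Nat.card_Icc, nsmul_eq_mul]
        push_cast [Nat.add_sub_cancel]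
        ring

end IsCausalProcess

end Limit

/-! ### Passage from truncated processes to the full process -/

section FullProcess

variable {Ω : Type*} {mΩ : MeasurableSpace Ω} {μ : Measure Ω} {J : Type*}

/-- The functional of the array `Y` at time `t`. -/
def fullEval (G : ℤ → (J → ℤ → ℝ) → ℝ) (Y : J → ℤ → Ω → ℝ) (t : ℤ) (ω : Ω) : ℝ :=
  G t fun j τ => Y j τ ω

theorem abs_truncArray_le_abs (Y : J → ℤ → Ω → ℝ) (k : ℕ) (s : ℤ) (ω : Ω) (j : J) (τ : ℤ) :
    |truncArray Y k s ω j τ| ≤ |Y j τ ω| := by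
  unfold truncArray
  split_ifs
  · exact abs_clip_le_abs _ _
  · simp

theorem abs_truncArray_sub_le (Y : J → ℤ → Ω → ℝ) (k : ℕ) (s : ℤ) (ω : Ω) (j : J) (τ : ℤ) :
    |truncArray Y k s ω j τ - Y j τ ω| ≤ |Y j τ ω| := by
  unfold truncArray
  split_ifs
  · obtain ⟨l, hl⟩ := exists_nat_ge (max |Y j τ ω| k)
    have h := abs_clip_sub_clip_le (k := k) (l := l)
      (by exact_mod_cast (le_max_right _ _).trans hl) (Y j τ ω)
    rwa [clip_of_abs_le ((le_max_left _ _).trans hl), abs_sub_comm] at h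
  · simp

/-- The centred functional. -/
noncomputable def centEval (μ : Measure Ω) (G : ℤ → (J → ℤ → ℝ) → ℝ)
    (Y : J → ℤ → Ω → ℝ) (t : ℤ) (ω : Ω) : ℝ :=
  fullEval G Y t ω - ∫ ω', fullEval G Y t ω' ∂μ

theorem arraySummable_truncArray (Y : J → ℤ → Ω → ℝ) (k : ℕ) (s t : ℤ) (ω : Ω) :
    ArraySummable t (truncArray Y k s ω) :=
  arraySummable_of_eq_zero (t - s).toNat fun _ _ h => truncArray_eq_zero Y k (by omega) ω _

/-- At level zero the array is zero and the functional is deterministic. Thus the bounds for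
differences, taken at `k = 0`, are moment bounds for the processes themselves. -/
theorem centTrunc_zero [IsProbabilityMeasure μ] (G : ℤ → (J → ℤ → ℝ) → ℝ)
    (Y : J → ℤ → Ω → ℝ) (t : ℤ) (ω : Ω) :
    centTrunc μ G Y 0 t ω = 0 := by
  simp [centTrunc, truncEval, truncArray_zero]

variable [Fintype J]

namespace IsCausalProcess

variable {𝓕 : Set ℤ → MeasurableSpace Ω} {G : ℤ → (J → ℤ → ℝ) → ℝ} {Y : J → ℤ → Ω → ℝ}
  {c K Λ : ℝ} [IsProbabilityMeasure μ]

/-- The weighted past of the array is summable and has an integrable sum. -/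
theorem ae_summable_past (hP : IsCausalProcess 𝓕 μ G Y c K Λ) (t : ℤ) :
    (∀ᵐ ω ∂μ, Summable fun h : ℕ => lagWeight h * ∑ j, |Y j (t - h) ω|) ∧
      Integrable (fun ω => ∑' h : ℕ, lagWeight h * ∑ j, |Y j (t - h) ω|) μ := by
  have hY : ∀ j τ, Measurable (Y j τ) := fun j τ => (hP.measurable j τ).mono (hP.field.le _) le_rfl
  let f : ℕ → Ω → ℝ := fun h ω => lagWeight h * ∑ j, |Y j (t - h) ω|
  have hf0 : ∀ h ω, 0 ≤ f h ω := fun h ω =>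
    mul_nonneg (lagWeight_nonneg h) (Finset.sum_nonneg fun _ _ => abs_nonneg _)
  have hfm : ∀ h, Measurable (f h) := fun h =>
    (Finset.measurable_sum _ fun j _ => (hY j _).abs).const_mul _
  have hfin : ∫⁻ ω, ∑' h, ENNReal.ofReal (f h ω) ∂μ ≠ ∞ := by
    rw [lintegral_tsum fun h => (hfm h).ennreal_ofReal.aemeasurable]
    have hb : ∀ h, ∫⁻ ω, ENNReal.ofReal (f h ω) ∂μ
        ≤ ENNReal.ofReal (lagWeight h * (Fintype.card J * (1 + K))) := fun h => by
      have hi1 : ∀ j, Integrable (fun ω => 1 + Y j (t - h) ω ^ 2) μ := fun j =>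
        (integrable_const 1).add (hP.integrable_sq j _)
      have hle : ∀ ω, f h ω ≤ lagWeight h * ∑ j, (1 + Y j (t - h) ω ^ 2) := fun ω => by
        refine mul_le_mul_of_nonneg_left (Finset.sum_le_sum fun j _ => ?_) (lagWeight_nonneg h)
        nlinarith [sq_nonneg (|Y j (t - h) ω| - 1), sq_abs (Y j (t - h) ω),
          abs_nonneg (Y j (t - h) ω)]
      have hi2 : Integrable (fun ω => lagWeight h * ∑ j, (1 + Y j (t - h) ω ^ 2)) μ :=
        (integrable_finsetSum _ fun j _ => hi1 j).const_mul _
      have hi3 : Integrable (f h) μ := by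
        refine hi2.mono' (hfm h).aestronglyMeasurable (ae_of_all _ fun ω => ?_)
        rw [Real.norm_eq_abs, abs_of_nonneg (hf0 h ω)]
        exact hle ω
      rw [← ofReal_integral_eq_lintegral_ofReal hi3 (ae_of_all _ (hf0 h))]
      refine ENNReal.ofReal_le_ofReal ?_
      calc ∫ ω, f h ω ∂μ ≤ ∫ ω, lagWeight h * ∑ j, (1 + Y j (t - h) ω ^ 2) ∂μ :=
            integral_mono hi3 hi2 hle
        _ = lagWeight h * ∑ j, (1 + ∫ ω, Y j (t - h) ω ^ 2 ∂μ) := by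
            rw [integral_const_mul, integral_finsetSum _ fun j _ => hi1 j]
            congr 1
            refine Finset.sum_congr rfl fun j _ => ?_
            rw [integral_add (integrable_const 1) (hP.integrable_sq j _)]
            simp
        _ ≤ lagWeight h * ∑ _j : J, (1 + K) :=
            mul_le_mul_of_nonneg_left (Finset.sum_le_sum fun j _ =>
              add_le_add_right (hP.integral_sq_le j _) 1) (lagWeight_nonneg h)
        _ = _ := by rw [Finset.sum_const, Finset.card_univ, nsmul_eq_mul]
    refine ne_top_of_le_ne_top ?_ (ENNReal.tsum_le_tsum hb)
    exact (summable_lagWeight.mul_right _).tsum_ofReal_ne_top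
  have hm : Measurable fun ω => ∑' h, ENNReal.ofReal (f h ω) :=
    Measurable.tsum fun h => (hfm h).ennreal_ofReal
  refine ⟨?_, ?_⟩
  · filter_upwards [ae_lt_top hm hfin] with ω hω
    have := ENNReal.summable_toReal hω.ne
    simpa only [ENNReal.toReal_ofReal (hf0 _ ω)] using this
  · refine (integrable_toReal_of_lintegral_ne_top hm.aemeasurable hfin).congr
      (ae_of_all _ fun ω => ?_)
    simp only
    rw [ENNReal.tsum_toReal_eq fun _ => ENNReal.ofReal_ne_top]
    exact tsum_congr fun h => ENNReal.toReal_ofReal (hf0 h ω)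

theorem arraySummable_of_summable {t : ℤ} {ω : Ω}
    (hω : Summable fun h : ℕ => lagWeight h * ∑ j, |Y j (t - h) ω|) :
    ArraySummable t fun j τ => Y j τ ω := fun j => by
  refine hω.of_nonneg_of_le (fun h => mul_nonneg (lagWeight_nonneg h) (abs_nonneg _)) fun h => ?_
  exact mul_le_mul_of_nonneg_left (Finset.single_le_sum (f := fun j => |Y j (t - h) ω|)
    (fun _ _ => abs_nonneg _) (Finset.mem_univ j)) (lagWeight_nonneg h)

/-- Dominated convergence for the sum over the lags: a fixed lag `h` is inside the window once `k >
h`, its clip is eventually exact, and the summable past dominates. -/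
theorem ae_tendsto_truncEval (hP : IsCausalProcess 𝓕 μ G Y c K Λ) (t : ℤ) :
    ∀ᵐ ω ∂μ, Tendsto (fun k : ℕ => truncEval G Y k (t - k) t ω) atTop
      (𝓝 (fullEval G Y t ω)) := by
  filter_upwards [(hP.ae_summable_past t).1] with ω hω
  rw [tendsto_iff_dist_tendsto_zero]
  refine squeeze_zero (fun _ => dist_nonneg) (fun k => hP.lipschitz.abs_sub_le t _ _
    (arraySummable_truncArray Y k (t - k) t ω) (arraySummable_of_summable hω)) ?_
  have h0 : Tendsto (fun k : ℕ => ∑' h : ℕ, lagWeight h *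
      ∑ j, |truncArray Y k (t - k) ω j (t - h) - Y j (t - h) ω|) atTop
      (𝓝 (∑' _h : ℕ, (0 : ℝ))) := by
    refine tendsto_tsum_of_dominated_convergence hω (fun h => ?_) ?_
    · have hj : ∀ j, Tendsto (fun k : ℕ => |truncArray Y k (t - k) ω j (t - h) - Y j (t - h) ω|)
          atTop (𝓝 0) := fun j => by
        have h1 : Tendsto (fun k : ℕ => truncArray Y k (t - k) ω j (t - h)) atTop
            (𝓝 (Y j (t - h) ω)) := by
          refine (tendsto_clip (Y j (t - h) ω)).congr' ?_
          filter_upwards [eventually_gt_atTop h] with k hk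
          rw [truncArray, if_pos (by omega)]
        simpa using (h1.sub_const (Y j (t - h) ω)).abs
      have := (tendsto_finsetSum Finset.univ fun j _ => hj j).const_mul (lagWeight h)
      simpa using this
    · refine Eventually.of_forall fun k h => ?_
      rw [Real.norm_eq_abs, abs_of_nonneg (mul_nonneg (lagWeight_nonneg h)
        (Finset.sum_nonneg fun _ _ => abs_nonneg _))]
      exact mul_le_mul_of_nonneg_left (Finset.sum_le_sum fun j _ =>
        abs_truncArray_sub_le Y k _ ω j _) (lagWeight_nonneg h)
  rw [tsum_zero] at h0
  simpa using h0.const_mul c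

theorem tendsto_integral_truncEval (hP : IsCausalProcess 𝓕 μ G Y c K Λ) (t : ℤ) :
    Tendsto (fun k : ℕ => ∫ ω, truncEval G Y k (t - k) t ω ∂μ) atTop
      (𝓝 (∫ ω, fullEval G Y t ω ∂μ)) := by
  obtain ⟨hs, hi⟩ := hP.ae_summable_past t
  refine tendsto_integral_of_dominated_convergence
    (fun ω => c * (∑' h : ℕ, lagWeight h * ∑ j, |Y j (t - h) ω|) + |G t 0|)
    (fun k => ((hP.isBddMeasurable_truncEval k _ t).mono (hP.field.le _)).1.aestronglyMeasurable)
    ((hi.const_mul c).add (integrable_const _)) (fun k => ?_) (hP.ae_tendsto_truncEval t)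
  filter_upwards [hs] with ω hω
  have h0 : ArraySummable t (0 : J → ℤ → ℝ) := fun j => by simp
  have h1 := hP.lipschitz.abs_sub_le t _ _ (arraySummable_truncArray Y k (t - k) t ω) h0
  have hle : ∀ h : ℕ, lagWeight h * ∑ j, |truncArray Y k (t - k) ω j (t - h)
      - (0 : J → ℤ → ℝ) j (t - h)| ≤ lagWeight h * ∑ j, |Y j (t - h) ω| := fun h =>
    mul_le_mul_of_nonneg_left (Finset.sum_le_sum fun j _ => by
      simpa using abs_truncArray_le_abs Y k (t - k) ω j (t - h)) (lagWeight_nonneg h)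
  have h2 := Summable.tsum_le_tsum hle (hω.of_nonneg_of_le (fun h =>
    mul_nonneg (lagWeight_nonneg h) (Finset.sum_nonneg fun _ _ => abs_nonneg _)) hle) hω
  have h3 := mul_le_mul_of_nonneg_left h2 hP.lipschitz.nonneg
  have h4 := abs_sub_abs_le_abs_sub (truncEval G Y k (t - k) t ω) (G t 0)
  rw [truncEval] at h4 ⊢
  rw [Real.norm_eq_abs]
  linarith

theorem ae_tendsto_centTrunc (hP : IsCausalProcess 𝓕 μ G Y c K Λ) (t : ℤ) :
    ∀ᵐ ω ∂μ, Tendsto (fun k : ℕ => centTrunc μ G Y k t ω) atTop (𝓝 (centEval μ G Y t ω)) := by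
  filter_upwards [hP.ae_tendsto_truncEval t] with ω hω
  exact hω.sub (hP.tendsto_integral_truncEval t)

theorem aemeasurable_centEval (hP : IsCausalProcess 𝓕 μ G Y c K Λ) (t : ℤ) :
    AEMeasurable (centEval μ G Y t) μ :=
  aemeasurable_of_tendsto_metrizable_ae atTop
    (fun k => ((hP.isBddMeasurable_centTrunc k t).mono (hP.field.le _)).1.aemeasurable)
    (hP.ae_tendsto_centTrunc t)

/-- The weighted sums of the process have variances of linear growth, and they are approximated by
those of the truncated processes. -/
theorem lintegral_sum_centEval_sub_sq_le (hP : IsCausalProcess 𝓕 μ G Y c K Λ) (k : ℕ)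
    {x : ℕ → ℝ} {B : ℝ} (hx : ∀ t, |x t| ≤ B) (N : ℕ) :
    ∫⁻ ω, ‖∑ t ∈ Finset.Icc 1 N,
        x t * (centEval μ G Y (t : ℤ) ω - centTrunc μ G Y k (t : ℤ) ω)‖ₑ ^ 2 ∂μ
      ≤ ENNReal.ofReal (144 * B ^ 2 * Λ ^ 2 / (k + 1) * N) := by
  let F : ℕ → Ω → ℝ := fun l ω => ∑ t ∈ Finset.Icc 1 N,
    x t * (centTrunc μ G Y l (t : ℤ) ω - centTrunc μ G Y k (t : ℤ) ω)
  have hF : ∀ l, IsBddMeasurable mΩ (F l) := fun l => IsBddMeasurable.sum fun t _ =>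
    (IsBddMeasurable.const (x t)).mul
      (((hP.isBddMeasurable_centTrunc l t).mono (hP.field.le _)).sub
        ((hP.isBddMeasurable_centTrunc k t).mono (hP.field.le _)))
  have hlim : ∀ᵐ ω ∂μ, liminf (fun l => ‖F l ω‖ₑ ^ 2) atTop
      = ‖∑ t ∈ Finset.Icc 1 N,
        x t * (centEval μ G Y (t : ℤ) ω - centTrunc μ G Y k (t : ℤ) ω)‖ₑ ^ 2 := by
    filter_upwards [ae_all_iff.2 fun t : ℕ => hP.ae_tendsto_centTrunc (t : ℤ)] with ω hω
    refine Tendsto.liminf_eq ?_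
    refine ENNReal.Tendsto.pow (Tendsto.enorm ?_)
    exact tendsto_finsetSum _ fun t _ => ((hω t).sub_const _).const_mul _
  rw [← lintegral_congr_ae hlim]
  -- Fatou's lemma as `l → ∞` with `k` fixed; the bound for `l ≥ k` does not depend on `l`.
  refine (lintegral_liminf_le' fun l => ((hF l).1.enorm.pow_const 2).aemeasurable).trans ?_
  refine liminf_le_of_frequently_le' (Eventually.frequently ?_)
  filter_upwards [eventually_ge_atTop k] with l hl
  have e : ∀ ω, ‖F l ω‖ₑ ^ 2 = ENNReal.ofReal (F l ω ^ 2) := fun ω => by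
    rw [← sq_abs, ENNReal.ofReal_pow (abs_nonneg _), Real.enorm_eq_ofReal_abs]
  simp_rw [e]
  rw [← ofReal_integral_eq_lintegral_ofReal (hF l).sq.integrable (ae_of_all _ fun _ => sq_nonneg _)]
  exact ENNReal.ofReal_le_ofReal (hP.integral_sum_centTrunc_sub_sq_le hl hx N)

end IsCausalProcess

end FullProcess

/-! ### Deviations of the squared norm of the score -/

section Deviation

variable {Ω : Type*} {mΩ : MeasurableSpace Ω} {μ : Measure Ω}

/-- Markov's inequality; the `p` coordinates of the score contribute `C * T` each to the mean. -/
theorem meas_le_scoreSq_le {x : ℕ → ℕ → ℝ} {T : ℕ} {e : ℤ → Ω → ℝ} {C : ℝ}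
    (he : ∀ t, AEMeasurable (e t) μ)
    (h : ∀ j, ∫⁻ ω, ‖score x T (fun t => e t ω) j‖ₑ ^ 2 ∂μ ≤ ENNReal.ofReal (C * T))
    (p : ℕ) {a : ℝ} (ha : 0 < a) :
    μ {ω | a ≤ scoreSq x T p fun t => e t ω} ≤ ENNReal.ofReal (C * (p * T) / a) := by
  have hs : ∀ j, AEMeasurable (fun ω => score x T (fun t => e t ω) j) μ := fun j =>
    Finset.aemeasurable_fun_sum _ fun t _ => (he t).const_mul _
  have hm : AEMeasurable (fun ω => ENNReal.ofReal (scoreSq x T p fun t => e t ω)) μ :=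
    (Finset.aemeasurable_fun_sum _ fun j _ => (hs j).pow_const 2).ennreal_ofReal
  have hfin : ∫⁻ ω, ENNReal.ofReal (scoreSq x T p fun t => e t ω) ∂μ
      ≤ ENNReal.ofReal (C * (p * T)) := by
    have e1 : ∀ ω, ENNReal.ofReal (scoreSq x T p fun t => e t ω)
        = ∑ j ∈ Finset.range p, ‖score x T (fun t => e t ω) j‖ₑ ^ 2 := fun ω => by
      rw [scoreSq, ENNReal.ofReal_sum_of_nonneg fun _ _ => sq_nonneg _]
      refine Finset.sum_congr rfl fun j _ => ?_
      rw [← sq_abs, ENNReal.ofReal_pow (abs_nonneg _), Real.enorm_eq_ofReal_abs]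
    simp_rw [e1]
    rw [lintegral_finsetSum' _ fun j _ => (hs j).enorm.pow_const 2]
    refine (Finset.sum_le_sum fun j _ => h j).trans_eq ?_
    rw [Finset.sum_const, Finset.card_range, nsmul_eq_mul, ← ENNReal.ofReal_natCast,
      ← ENNReal.ofReal_mul (by positivity)]
    congr 1
    ring
  have hmk := meas_ge_le_lintegral_div hm (ε := ENNReal.ofReal a)
    (ENNReal.ofReal_pos.2 ha).ne' ENNReal.ofReal_ne_top
  rw [ENNReal.ofReal_div_of_pos ha]
  refine le_trans (measure_mono fun ω hω => ?_) (hmk.trans (ENNReal.div_le_div_right hfin _))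
  exact ENNReal.ofReal_le_ofReal hω

theorem scoreSq_le_two_mul_add (x : ℕ → ℕ → ℝ) (T p : ℕ) (e f : ℤ → ℝ) :
    scoreSq x T p e ≤ 2 * scoreSq x T p f + 2 * scoreSq x T p (fun t => e t - f t) := by
  rw [scoreSq, scoreSq, scoreSq, Finset.mul_sum, Finset.mul_sum, ← Finset.sum_add_distrib]
  refine Finset.sum_le_sum fun j _ => ?_
  have h : score x T (fun t => e t - f t) j = score x T e j - score x T f j := by
    simp [score, mul_sub]
  rw [h]
  nlinarith [sq_nonneg (score x T e j - 2 * score x T f j)]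

theorem scoreSq_eq_quadForm (x : ℕ → ℕ → ℝ) (T p : ℕ) (e : ℤ → ℝ) :
    scoreSq x T p e = ∑ P ∈ Finset.Icc 1 T ×ˢ Finset.Icc 1 T,
      (∑ j ∈ Finset.range p, x P.1 j * x P.2 j) * (e P.1 * e P.2) := by
  simp_rw [scoreSq, score, pow_two, Finset.sum_mul_sum]
  rw [Finset.sum_product, Finset.sum_comm]
  refine Finset.sum_congr rfl fun s _ => ?_
  rw [Finset.sum_comm]
  refine Finset.sum_congr rfl fun t _ => ?_
  rw [Finset.sum_mul]
  exact Finset.sum_congr rfl fun j _ => by ring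

variable {J : Type*} [Fintype J] [IsProbabilityMeasure μ]
  {𝓕 : Set ℤ → MeasurableSpace Ω} {G : ℤ → (J → ℤ → ℝ) → ℝ} {Y : J → ℤ → Ω → ℝ} {c K Λ : ℝ}

namespace IsCausalProcess

/-- Concentration of the squared norm of the score of a truncated process. -/
theorem meas_le_scoreSq_centTrunc_le (hP : IsCausalProcess 𝓕 μ G Y c K Λ) (k : ℕ)
    {x : ℕ → ℕ → ℝ} {B : ℝ} (hB : 0 < B) (hx : ∀ t j, |x t j| ≤ B) (b : ℝ) :
    ∃ M : ℝ, 0 ≤ M ∧ ∀ T p : ℕ, 1 ≤ T → 1 ≤ p →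
      (∀ κ ∈ spectrum ℝ (gramMatrix x T p), 0 ≤ κ ∧ κ ≤ b) →
      μ {ω | 2 * (144 * B ^ 2 * Λ ^ 2) * (p * T)
          ≤ scoreSq x T p fun t => centTrunc μ G Y k t ω}
        ≤ ENNReal.ofReal (M * (1 / p + 1 / T)) := by
  have hΛ := hP.pos
  set C₁ : ℝ := 144 * B ^ 2 * Λ ^ 2 with hC₁
  have hC₁0 : 0 < C₁ := by positivity
  set R : ℝ := 4 * (c * Fintype.card J) * k with hR
  -- `M₁` belongs to the squared Frobenius norm `T² p b²`, and `M₂` to the `T` diagonal terms of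
  -- size `(p B²)²`. After division by `(C₁ p T)²` they leave `1/p` and `1/T`.
  set M₁ : ℝ := 2 * (2 * k + 1) ^ 2 * b ^ 2 with hM₁
  set M₂ : ℝ := (6 * k + 1) ^ 2 * (18 * k + 1) * B ^ 4 with hM₂
  have hM₁0 : 0 ≤ M₁ := by positivity
  have hM₂0 : 0 ≤ M₂ := by positivity
  refine ⟨2 * R ^ 4 * (M₁ + M₂) / C₁ ^ 2, by positivity, fun T p hT hp hspec => ?_⟩
  have hT' : (0 : ℝ) < T := by exact_mod_cast hT
  have hp' : (0 : ℝ) < p := by exact_mod_cast hp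
  let e : ℤ → Ω → ℝ := centTrunc μ G Y k
  have he : ∀ t, IsBddMeasurable mΩ (e t) := fun t =>
    (hP.isBddMeasurable_centTrunc k t).mono (hP.field.le _)
  let a : ℕ → ℕ → ℝ := fun s t => ∑ j ∈ Finset.range p, x s j * x t j
  have ha : ∀ s t, |a s t| ≤ p * B ^ 2 := fun s t => by
    refine (Finset.abs_sum_le_sum_abs _ _).trans ?_
    calc ∑ j ∈ Finset.range p, |x s j * x t j| ≤ ∑ _j ∈ Finset.range p, B ^ 2 := by
          refine Finset.sum_le_sum fun j _ => ?_
          rw [abs_mul, pow_two]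
          exact mul_le_mul (hx s j) (hx t j) (abs_nonneg _) hB.le
      _ = _ := by simp
  let Q : Ω → ℝ := fun ω => scoreSq x T p fun t => e t ω
  let W : Ω → ℝ := fun ω => ∑ P ∈ Finset.Icc 1 T ×ˢ Finset.Icc 1 T,
    a P.1 P.2 * (e P.1 ω * e P.2 ω - ∫ ω', e P.1 ω' * e P.2 ω' ∂μ)
  have hW : IsBddMeasurable mΩ W := IsBddMeasurable.sum fun P _ =>
    (IsBddMeasurable.const _).mul (((he _).mul (he _)).sub (IsBddMeasurable.const _))
  have hvar := hP.field.variance_quadForm_le (hP.isBddMeasurable_centTrunc k)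
    (hP.abs_centTrunc_le k) (hP.integral_centTrunc k) (Finset.Icc 1 T) a (p * B ^ 2) ha
  have hQW : ∀ ω, Q ω = W ω + ∫ ω', Q ω' ∂μ := fun ω => by
    have hI : ∫ ω', Q ω' ∂μ = ∑ P ∈ Finset.Icc 1 T ×ˢ Finset.Icc 1 T,
        a P.1 P.2 * ∫ ω', e P.1 ω' * e P.2 ω' ∂μ := by
      simp only [Q, scoreSq_eq_quadForm]
      rw [integral_finsetSum _ fun P _ =>
        ((he _).mul (he _)).integrable.const_mul _]
      simp_rw [integral_const_mul]
      rfl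
    rw [hI]
    simp only [Q, scoreSq_eq_quadForm, W]
    rw [← Finset.sum_add_distrib]
    exact Finset.sum_congr rfl fun P _ => by ring
  have hEQ : ∫ ω, Q ω ∂μ ≤ C₁ * (p * T) := by
    have hs : ∀ j, IsBddMeasurable mΩ fun ω => score x T (fun t => e t ω) j := fun j =>
      IsBddMeasurable.sum fun t _ => (IsBddMeasurable.const _).mul (he _)
    simp only [Q, scoreSq]
    rw [integral_finsetSum _ fun j _ => (hs j).sq.integrable]
    calc ∑ j ∈ Finset.range p, ∫ ω, score x T (fun t => e t ω) j ^ 2 ∂μ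
        ≤ ∑ _j ∈ Finset.range p, C₁ * T := by
          refine Finset.sum_le_sum fun j _ => ?_
          have := hP.integral_sum_centTrunc_sub_sq_le (Nat.zero_le k) (fun t => hx t j) T
          simp only [centTrunc_zero, sub_zero, Nat.cast_zero, zero_add, div_one] at this
          exact this
      _ = _ := by rw [Finset.sum_const, Finset.card_range, nsmul_eq_mul]; ring
  have hfro := sum_sq_outerGram_le hT hspec
  have hvar' : ∫ ω, W ω ^ 2 ∂μ ≤ 2 * R ^ 4 * (M₁ * (T ^ 2 * p) + M₂ * (T * p ^ 2)) := by
    refine hvar.trans (mul_le_mul_of_nonneg_left ?_ (by positivity))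
    rw [Finset.sum_product, Nat.card_Icc, Nat.add_sub_cancel]
    have := mul_le_mul_of_nonneg_left hfro (by positivity : (0 : ℝ) ≤ 2 * (2 * k + 1) ^ 2)
    simp only [a]
    refine (add_le_add_left this _).trans_eq ?_
    rw [hM₁, hM₂]
    ring
  have hmk := mul_meas_ge_le_integral_of_nonneg (μ := μ) (f := fun ω => W ω ^ 2)
    (ae_of_all _ fun _ => sq_nonneg _) hW.sq.integrable ((C₁ * (p * T)) ^ 2)
  have hreal : μ.real {ω | (C₁ * (p * T)) ^ 2 ≤ W ω ^ 2}
      ≤ 2 * R ^ 4 * (M₁ + M₂) / C₁ ^ 2 * (1 / p + 1 / T) := by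
    have h1 := hmk.trans hvar'
    rw [mul_comm, ← le_div_iff₀ (by positivity)] at h1
    refine h1.trans ?_
    have e1 : 2 * R ^ 4 * (M₁ * (T ^ 2 * p) + M₂ * (T * p ^ 2)) / (C₁ * (p * T)) ^ 2
        = 2 * R ^ 4 / C₁ ^ 2 * (M₁ * (1 / p) + M₂ * (1 / T)) := by field_simp
    have e2 : 2 * R ^ 4 * (M₁ + M₂) / C₁ ^ 2 * (1 / p + 1 / T)
        = 2 * R ^ 4 / C₁ ^ 2 * ((M₁ + M₂) * (1 / p + 1 / T)) := by ring
    rw [e1, e2]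
    refine mul_le_mul_of_nonneg_left ?_ (by positivity)
    have : (0 : ℝ) ≤ 1 / p := by positivity
    have : (0 : ℝ) ≤ 1 / T := by positivity
    nlinarith [mul_nonneg hM₁0 this]
  rw [← ENNReal.ofReal_toReal (measure_ne_top μ _)]
  refine ENNReal.ofReal_le_ofReal (le_trans (measureReal_mono fun ω hω => ?_) hreal)
  -- `W` is `Q` minus its mean, and the mean is at most `C₁ p T`; a value of `Q` above twice this
  -- bound is a deviation of `W` by `C₁ p T`.
  have h1 : 2 * C₁ * (p * T) ≤ Q ω := hω
  have h2 := hQW ω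
  have h3 : C₁ * (p * T) ≤ W ω := by linarith
  exact pow_le_pow_left₀ (by positivity) h3 2

/-- The squared norm of the score is at most of the order of its mean, with probability tending
to one as the sample size and the dimension increase. -/
theorem exists_meas_le_scoreSq_le (hP : IsCausalProcess 𝓕 μ G Y c K Λ)
    {x : ℕ → ℕ → ℝ} {B : ℝ} (hB : 0 < B) (hx : ∀ t j, |x t j| ≤ B) (b : ℝ) {δ : ℝ} (hδ : 0 < δ) :
    ∃ n₀ : ℕ, ∀ T p : ℕ, n₀ ≤ T → n₀ ≤ p → 1 ≤ T → 1 ≤ p →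
      (∀ κ ∈ spectrum ℝ (gramMatrix x T p), 0 ≤ κ ∧ κ ≤ b) →
      μ {ω | 8 * (144 * B ^ 2 * Λ ^ 2) * (p * T) ≤ scoreSq x T p fun t => centEval μ G Y t ω}
        ≤ ENNReal.ofReal δ := by
  have hΛ := hP.pos
  -- The remainder beyond level `k` exceeds `2 C₁ p T` with probability at most `1/(2(k+1)) < δ/2`.
  -- The level is fixed before `n₀`, since `M` depends on `k`.
  obtain ⟨k, hk⟩ := exists_nat_one_div_lt hδ
  obtain ⟨M, hM0, hM⟩ := hP.meas_le_scoreSq_centTrunc_le k hB hx b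
  obtain ⟨n₀, hn₀⟩ := exists_nat_ge (4 * M / δ)
  refine ⟨n₀, fun T p hT₀ hp₀ hT hp hspec => ?_⟩
  have hT' : (0 : ℝ) < T := by exact_mod_cast hT
  have hp' : (0 : ℝ) < p := by exact_mod_cast hp
  set C₁ : ℝ := 144 * B ^ 2 * Λ ^ 2 with hC₁
  have hC₁0 : 0 < C₁ := by positivity
  have h1 : μ {ω | 2 * C₁ * (p * T) ≤ scoreSq x T p fun t => centTrunc μ G Y k t ω}
      ≤ ENNReal.ofReal (δ / 2) := by
    refine (hM T p hT hp hspec).trans (ENNReal.ofReal_le_ofReal ?_)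
    have key : ∀ n : ℕ, n₀ ≤ n → (0 : ℝ) < n → M * (1 / n) ≤ δ / 4 := fun n hn hn' => by
      have : 4 * M / δ ≤ n := hn₀.trans (by exact_mod_cast hn)
      rw [div_le_iff₀ hδ] at this
      rw [mul_one_div, div_le_iff₀ hn']
      linarith
    have := key T hT₀ hT'
    have := key p hp₀ hp'
    linarith
  have h2 : μ {ω | 2 * C₁ * (p * T)
        ≤ scoreSq x T p fun t => centEval μ G Y t ω - centTrunc μ G Y k t ω}
      ≤ ENNReal.ofReal (δ / 2) := by
    refine (meas_le_scoreSq_le (C := C₁ / (k + 1))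
      (fun t => (hP.aemeasurable_centEval t).sub
        ((hP.isBddMeasurable_centTrunc k t).mono (hP.field.le _)).1.aemeasurable)
      (fun j => hP.lintegral_sum_centEval_sub_sq_le k (fun t => hx t j) T) p
      (by positivity)).trans (ENNReal.ofReal_le_ofReal ?_)
    have e : C₁ / ((k : ℝ) + 1) * (p * T) / (2 * C₁ * (p * T)) = 1 / ((k : ℝ) + 1) / 2 := by
      field_simp
    rw [e]
    linarith
  calc μ {ω | 8 * C₁ * (p * T) ≤ scoreSq x T p fun t => centEval μ G Y t ω}
      ≤ μ ({ω | 2 * C₁ * (p * T) ≤ scoreSq x T p fun t => centTrunc μ G Y k t ω} ∪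
        {ω | 2 * C₁ * (p * T)
          ≤ scoreSq x T p fun t => centEval μ G Y t ω - centTrunc μ G Y k t ω}) := by
        refine measure_mono fun ω hω => ?_
        by_contra hcon
        simp only [Set.mem_union, Set.mem_ofPred_eq, not_or, not_le] at hcon hω
        -- The threshold is `8 C₁ p T` because each of the two parts, bounded by `2 C₁ p T`, enters
        -- with a factor `2`.
        have := scoreSq_le_two_mul_add x T p (fun t => centEval μ G Y t ω)
          (fun t => centTrunc μ G Y k t ω)
        linarith [hcon.1, hcon.2]
    _ ≤ ENNReal.ofReal (δ / 2) + ENNReal.ofReal (δ / 2) :=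
        (measure_union_le _ _).trans (add_le_add h1 h2)
    _ = ENNReal.ofReal δ := by
        rw [← ENNReal.ofReal_add (by positivity) (by positivity), add_halves]

end IsCausalProcess

end Deviation

/-! ### The error model as a causal process -/

namespace ErrorModel

variable {d L m q : ℕ} {Ω : Type*}

/-- The error model with the array of innovation coordinates as sample point. -/
def arrayModel (M : ErrorModel d L m q Ω) :
    ErrorModel d L m q (Fin (L + 1) × Fin d → ℤ → ℝ) where
  innov ℓ t y κ := y (ℓ, κ) t
  coef := M.coef
  load := M.load
  weight := M.weight
  source := M.source
  pos := M.pos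
  H := M.H

/-- The error before centring, as a functional of the array of innovations. -/
noncomputable def functional (M : ErrorModel d L m q Ω) (ν : Fin d) (t : ℤ)
    (y : Fin (L + 1) × Fin d → ℤ → ℝ) : ℝ :=
  M.H (M.arrayModel.lagged t y) ν

/-- The array of innovation coordinates. -/
def innovArray (M : ErrorModel d L m q Ω) (k : Fin (L + 1) × Fin d) (τ : ℤ) (ω : Ω) : ℝ :=
  M.innov k.1 τ ω k.2

/-- Seen from time `t`, lag `j` of the process observed at `t - i` is lag `i + j`. As `i ≤ m` is
bounded, the shift costs only a constant. -/
theorem lagWeight_le_shift {m i : ℕ} (hi : i ≤ m) (j : ℕ) :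
    lagWeight j ≤ ((m : ℝ) + 1) ^ 4 * lagWeight (i + j) := by
  unfold lagWeight
  have hi' : (i : ℝ) ≤ m := by exact_mod_cast hi
  have h : ((i + j : ℕ) : ℝ) + 1 ≤ (m + 1) * (j + 1) := by
    push_cast
    nlinarith [mul_nonneg (Nat.cast_nonneg m : (0 : ℝ) ≤ m) (Nat.cast_nonneg j : (0 : ℝ) ≤ j)]
  rw [mul_one_div, div_le_div_iff₀ (by positivity) (by positivity), one_mul, ← mul_pow]
  exact pow_le_pow_left₀ (by positivity) h 4

/-- The exponent is at most `-5`, and `-4` suffices; `16 = 2⁴` comes from `j + 1 ≤ 2 max(j, 1)`. -/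
theorem rpow_le_lagWeight {θ : ℝ} (hθ : 3 / 2 ≤ θ) (j : ℕ) :
    (max (j : ℝ) 1) ^ (-(7 / 2 : ℝ) - θ) ≤ 16 * lagWeight j := by
  have h1 : (1 : ℝ) ≤ max (j : ℝ) 1 := le_max_right _ _
  calc (max (j : ℝ) 1) ^ (-(7 / 2 : ℝ) - θ) ≤ (max (j : ℝ) 1) ^ (-(4 : ℕ) : ℝ) :=
        Real.rpow_le_rpow_of_exponent_le h1 (by push_cast; linarith)
    _ = 1 / (max (j : ℝ) 1) ^ 4 := by
        rw [Real.rpow_neg (by positivity), Real.rpow_natCast, one_div]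
    _ ≤ 16 * lagWeight j := by
        unfold lagWeight
        rw [mul_one_div, div_le_div_iff₀ (by positivity) (by positivity), one_mul]
        have h2 : (j : ℝ) + 1 ≤ 2 * max (j : ℝ) 1 := by linarith [le_max_left (j : ℝ) 1]
        calc ((j : ℝ) + 1) ^ 4 ≤ (2 * max (j : ℝ) 1) ^ 4 :=
              pow_le_pow_left₀ (by positivity) h2 4
          _ = _ := by ring

/-- The weighted distance of the pasts of two arrays at time `t`. -/
noncomputable def pastDist {J : Type*} [Fintype J] (t : ℤ) (y y' : J → ℤ → ℝ) : ℝ :=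
  ∑' h : ℕ, lagWeight h * ∑ k, |y k (t - h) - y' k (t - h)|

theorem summable_pastDist {J : Type*} [Fintype J] {t : ℤ} {y y' : J → ℤ → ℝ}
    (hy : ArraySummable t y) (hy' : ArraySummable t y') :
    Summable fun h : ℕ => lagWeight h * ∑ k, |y k (t - h) - y' k (t - h)| := by
  simp_rw [Finset.mul_sum]
  refine summable_sum fun k _ => ?_
  refine ((hy k).add (hy' k)).of_nonneg_of_le
    (fun h => mul_nonneg (lagWeight_nonneg h) (abs_nonneg _)) fun h => ?_
  rw [← mul_add]
  exact mul_le_mul_of_nonneg_left (abs_sub _ _) (lagWeight_nonneg h)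

variable (M : ErrorModel d L m q Ω)

/-- By linearity the difference is the same series applied to `y - y'`. Splitting the `tsum` is
legitimate because both series converge for `ArraySummable` arrays. -/
theorem abs_linProc_sub_le {C : ℝ} (hC : 0 ≤ C)
    (hcoef : ∀ ℓ j ν κ, |M.coef ℓ j ν κ| ≤ C * lagWeight j) {t : ℤ}
    {y y' : Fin (L + 1) × Fin d → ℤ → ℝ} (hy : ArraySummable t y) (hy' : ArraySummable t y')
    (ℓ : Fin (L + 1)) {i : ℕ} (hi : i ≤ m) (ν : Fin d) :
    |M.arrayModel.linProc ℓ (t - i) y ν - M.arrayModel.linProc ℓ (t - i) y' ν|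
      ≤ C * (m + 1) ^ 4 * pastDist t y y' := by
  have hinj : Function.Injective fun j : ℕ => i + j := add_right_injective i
  have hterm : ∀ (z : Fin (L + 1) × Fin d → ℤ → ℝ) (j : ℕ),
      |(M.coef ℓ j *ᵥ fun κ => z (ℓ, κ) (t - i - j)) ν|
        ≤ C * (m + 1) ^ 4 * (lagWeight (i + j) * ∑ k, |z k (t - (i + j : ℕ))|) := fun z j => by
    have ht : t - i - j = t - (i + j : ℕ) := by push_cast; ring
    rw [ht]
    calc |(M.coef ℓ j *ᵥ fun κ => z (ℓ, κ) (t - (i + j : ℕ))) ν|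
        ≤ ∑ κ, |M.coef ℓ j ν κ * z (ℓ, κ) (t - (i + j : ℕ))| := by
          rw [Matrix.mulVec, dotProduct]
          exact Finset.abs_sum_le_sum_abs _ _
      _ ≤ ∑ κ, C * ((m + 1) ^ 4 * lagWeight (i + j)) * |z (ℓ, κ) (t - (i + j : ℕ))| := by
          refine Finset.sum_le_sum fun κ _ => ?_
          rw [abs_mul]
          exact mul_le_mul_of_nonneg_right ((hcoef ℓ j ν κ).trans
            (mul_le_mul_of_nonneg_left (lagWeight_le_shift hi j) hC)) (abs_nonneg _)
      _ = C * (m + 1) ^ 4 * (lagWeight (i + j) * ∑ κ, |z (ℓ, κ) (t - (i + j : ℕ))|) := by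
          rw [← Finset.mul_sum]; ring
      _ ≤ _ := by
          refine mul_le_mul_of_nonneg_left (mul_le_mul_of_nonneg_left ?_ (lagWeight_nonneg _))
            (by positivity)
          rw [Fintype.sum_prod_type]
          exact Finset.single_le_sum (f := fun ℓ => ∑ κ, |z (ℓ, κ) (t - (i + j : ℕ))|)
            (fun _ _ => Finset.sum_nonneg fun _ _ => abs_nonneg _) (Finset.mem_univ ℓ)
  have hsum : ∀ z : Fin (L + 1) × Fin d → ℤ → ℝ, ArraySummable t z →
      Summable fun j : ℕ => (M.coef ℓ j *ᵥ fun κ => z (ℓ, κ) (t - i - j)) ν := fun z hz => by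
    refine Summable.of_norm_bounded (((Summable.comp_injective
      (f := fun h : ℕ => lagWeight h * ∑ k, |z k (t - h)|) ?_ hinj)).mul_left _) (hterm z)
    simp_rw [Finset.mul_sum]
    exact summable_sum fun k _ => hz k
  have hd := summable_pastDist hy hy'
  change |∑' j : ℕ, (M.coef ℓ j *ᵥ fun κ => y (ℓ, κ) (t - i - j)) ν
    - ∑' j : ℕ, (M.coef ℓ j *ᵥ fun κ => y' (ℓ, κ) (t - i - j)) ν| ≤ _
  rw [← (hsum y hy).tsum_sub (hsum y' hy'), ← Real.norm_eq_abs]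
  refine (tsum_of_norm_bounded (((hd.comp_injective hinj).mul_left
    (C * (m + 1) ^ 4)).hasSum) fun j => ?_).trans ?_
  · have h := hterm (fun k τ => y k τ - y' k τ) j
    have e : (fun κ => y (ℓ, κ) (t - i - j) - y' (ℓ, κ) (t - i - j))
        = (fun κ => y (ℓ, κ) (t - i - j)) - fun κ => y' (ℓ, κ) (t - i - j) := rfl
    rw [e, Matrix.mulVec_sub] at h
    exact h
  · rw [tsum_mul_left]
    refine mul_le_mul_of_nonneg_left ?_ (by positivity)
    exact tsum_comp_le_tsum_of_inj hd (fun h => mul_nonneg (lagWeight_nonneg h)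
      (Finset.sum_nonneg fun _ _ => abs_nonneg _)) hinj

variable {M} [MeasurableSpace Ω] {μ : Measure Ω}

theorem Assumptions.isCausalLipschitz (hM : M.Assumptions μ) (ν : Fin d) :
    ∃ c, IsCausalLipschitz c (M.functional ν) := by
  obtain ⟨C, θ, hθ, hdecay⟩ := hM.decay
  obtain ⟨LH, hLH⟩ := hM.lipschitz
  set C' : ℝ := |C| * 16 with hC'
  have hcoef : ∀ ℓ j ν κ, |M.coef ℓ j ν κ| ≤ C' * lagWeight j := fun ℓ j ν κ => by
    refine (hdecay ℓ j ν κ).trans ?_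
    have h1 := mul_le_mul_of_nonneg_left (rpow_le_lagWeight hθ j) (abs_nonneg C)
    have h2 := mul_le_mul_of_nonneg_right (le_abs_self C)
      (Real.rpow_nonneg (by positivity : (0 : ℝ) ≤ max (j : ℝ) 1) (-(7 / 2 : ℝ) - θ))
    rw [hC']
    linarith
  -- The `+ 1` accounts for the idiosyncratic process, which enters with coefficient one. The factor
  -- weights lie in the unit interval, so the bound is uniform in the sites.
  set Φ : ℝ := ∑ ν, ∑ ℓ, |M.load ν ℓ| + 1 with hΦ
  set A : ℝ := C' * (m + 1) ^ 4 with hA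
  have hA0 : 0 ≤ A := by positivity
  have hΦ0 : 0 ≤ Φ := by positivity
  refine ⟨|LH| * (√((m + 1) * d) * (Φ * A)), by positivity, fun t y y' hy hy' => ?_⟩
  change _ ≤ _ * pastDist t y y'
  set S := pastDist t y y' with hS
  have hS0 : 0 ≤ S := tsum_nonneg fun h => mul_nonneg (lagWeight_nonneg h)
    (Finset.sum_nonneg fun _ _ => abs_nonneg _)
  have hfield : ∀ (i : Fin (m + 1)) (κ : Fin d),
      |M.arrayModel.lagged t y i κ - M.arrayModel.lagged t y' i κ| ≤ Φ * A * S := fun i κ => by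
    have hl := fun ℓ => M.abs_linProc_sub_le (by positivity) hcoef hy hy' ℓ
      (Nat.lt_succ_iff.1 i.2) κ
    change |(∑ ℓ : Fin L, M.load κ ℓ * M.weight (M.pos t i) (M.source ℓ)
        * M.arrayModel.linProc ℓ.succ (t - (i : ℕ)) y κ + M.arrayModel.linProc 0 (t - (i : ℕ)) y κ)
      - (∑ ℓ : Fin L, M.load κ ℓ * M.weight (M.pos t i) (M.source ℓ)
        * M.arrayModel.linProc ℓ.succ (t - (i : ℕ)) y' κ
        + M.arrayModel.linProc 0 (t - (i : ℕ)) y' κ)| ≤ _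
    rw [add_sub_add_comm, ← Finset.sum_sub_distrib]
    refine (abs_add_le _ _).trans ?_
    have h1 : |∑ ℓ : Fin L, (M.load κ ℓ * M.weight (M.pos t i) (M.source ℓ)
          * M.arrayModel.linProc ℓ.succ (t - (i : ℕ)) y κ
        - M.load κ ℓ * M.weight (M.pos t i) (M.source ℓ)
          * M.arrayModel.linProc ℓ.succ (t - (i : ℕ)) y' κ)| ≤ (∑ ℓ, |M.load κ ℓ|) * (A * S) := by
      refine (Finset.abs_sum_le_sum_abs _ _).trans ?_
      rw [Finset.sum_mul]
      refine Finset.sum_le_sum fun ℓ _ => ?_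
      rw [← mul_sub, abs_mul, abs_mul]
      have hw := hM.weight_ok.1 _ (hM.pos_mem t i) _ (hM.source_mem ℓ)
      rw [abs_of_nonneg hw.1]
      exact mul_le_mul (mul_le_of_le_one_right (abs_nonneg _) hw.2) (hl ℓ.succ) (abs_nonneg _)
        (abs_nonneg _)
    have h2 : ∑ ℓ, |M.load κ ℓ| ≤ ∑ ν, ∑ ℓ, |M.load ν ℓ| :=
      Finset.single_le_sum (f := fun ν => ∑ ℓ, |M.load ν ℓ|)
        (fun _ _ => Finset.sum_nonneg fun _ _ => abs_nonneg _) (Finset.mem_univ κ)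
    have h3 := mul_le_mul_of_nonneg_right h2 (mul_nonneg hA0 hS0)
    have h4 := hl 0
    calc _ ≤ (∑ ν, ∑ ℓ, |M.load ν ℓ|) * (A * S) + A * S := add_le_add (h1.trans h3) h4
      _ = _ := by rw [hΦ]; ring
  refine (hLH ν _ _).trans ?_
  have hsq : √(∑ i, ∑ κ, (M.arrayModel.lagged t y i κ - M.arrayModel.lagged t y' i κ) ^ 2)
      ≤ √((m + 1) * d) * (Φ * A * S) := by
    rw [Real.sqrt_le_iff]
    refine ⟨by positivity, ?_⟩
    rw [mul_pow, Real.sq_sqrt (by positivity)]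
    calc ∑ i, ∑ κ, (M.arrayModel.lagged t y i κ - M.arrayModel.lagged t y' i κ) ^ 2
        ≤ ∑ _i : Fin (m + 1), ∑ _κ : Fin d, (Φ * A * S) ^ 2 := by
          refine Finset.sum_le_sum fun i _ => Finset.sum_le_sum fun κ _ => ?_
          rw [← sq_abs]
          exact pow_le_pow_left₀ (abs_nonneg _) (hfield i κ) 2
      _ = _ := by simp; ring
  calc LH * √(∑ i, ∑ κ, (M.arrayModel.lagged t y i κ - M.arrayModel.lagged t y' i κ) ^ 2)
      ≤ |LH| * (√((m + 1) * d) * (Φ * A * S)) :=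
        mul_le_mul (le_abs_self _) hsq (Real.sqrt_nonneg _) (abs_nonneg _)
    _ = _ := by ring

/-- The σ-algebra of the innovations at the times in `A`. -/
abbrev innovField (M : ErrorModel d L m q Ω) (A : Set ℤ) : MeasurableSpace Ω :=
  ⨆ k ∈ {k : Fin (L + 1) × ℤ | k.2 ∈ A}, MeasurableSpace.comap (M.innov k.1 k.2) inferInstance

theorem Assumptions.isIndepField (hM : M.Assumptions μ) : IsIndepField M.innovField μ where
  mono _ _ hAB := biSup_mono fun _ hk => hAB hk
  le _ := iSup₂_le fun k _ => (hM.measurable_innov k.1 k.2).comap_le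
  indep _ _ hAB := indep_iSup_of_disjoint
    (m := fun k : Fin (L + 1) × ℤ => MeasurableSpace.comap (M.innov k.1 k.2) inferInstance)
    (fun k => (hM.measurable_innov k.1 k.2).comap_le) hM.indep
    (Set.disjoint_left.2 fun _ h1 h2 => Set.disjoint_left.1 hAB h1 h2)

theorem Assumptions.isCausalProcess [IsProbabilityMeasure μ] (hM : M.Assumptions μ) (ν : Fin d) :
    ∃ c K Λ, IsCausalProcess M.innovField μ (M.functional ν) M.innovArray c K Λ := by
  obtain ⟨c, hc⟩ := hM.isCausalLipschitz ν
  obtain ⟨K, hK⟩ := hM.fourth_moment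
  have hmeas : ∀ k τ, Measurable (M.innovArray k τ) := fun k τ =>
    (measurable_pi_apply k.2).comp (hM.measurable_innov k.1 τ)
  have e : ∀ k τ ω, ENNReal.ofReal ((M.innovArray k τ ω ^ 2) ^ 2) = ‖M.innov k.1 τ ω k.2‖ₑ ^ 4 :=
    fun k τ ω => by
      rw [← pow_mul, ← Even.pow_abs (by decide), ENNReal.ofReal_pow (abs_nonneg _),
        Real.enorm_eq_ofReal_abs]
      rfl
  have hl : ∀ k τ, ∫⁻ ω, ENNReal.ofReal ((M.innovArray k τ ω ^ 2) ^ 2) ∂μ ≤ ENNReal.ofReal K :=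
    fun k τ => by simpa only [e] using hK k.1 τ k.2
  have h4 : ∀ k τ, Integrable (fun ω => (M.innovArray k τ ω ^ 2) ^ 2) μ := fun k τ => by
    refine ⟨(((hmeas k τ).pow_const 2).pow_const 2).aestronglyMeasurable, ?_⟩
    rw [hasFiniteIntegral_iff_ofReal (ae_of_all _ fun _ => sq_nonneg _)]
    exact (hl k τ).trans_lt ENNReal.ofReal_lt_top
  have h4' : ∀ k τ, ∫ ω, (M.innovArray k τ ω ^ 2) ^ 2 ∂μ ≤ max K 0 := fun k τ => by
    rw [integral_eq_lintegral_of_nonneg_ae (ae_of_all _ fun _ => sq_nonneg _)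
      (h4 k τ).aestronglyMeasurable]
    refine (ENNReal.toReal_mono ENNReal.ofReal_ne_top (hl k τ)).trans_eq ?_
    rw [ENNReal.toReal_ofReal']
  have hpt : ∀ k τ ω, M.innovArray k τ ω ^ 2 ≤ 1 + (M.innovArray k τ ω ^ 2) ^ 2 := fun k τ ω => by
    nlinarith [sq_nonneg (M.innovArray k τ ω ^ 2 - 1), sq_nonneg (M.innovArray k τ ω)]
  have h2 : ∀ k τ, Integrable (fun ω => M.innovArray k τ ω ^ 2) μ := fun k τ => by
    refine ((integrable_const 1).add (h4 k τ)).mono' ((hmeas k τ).pow_const 2).aestronglyMeasurable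
      (ae_of_all _ fun ω => ?_)
    rw [Real.norm_eq_abs, abs_of_nonneg (sq_nonneg _)]
    exact hpt k τ ω
  have h2' : ∀ k τ, ∫ ω, M.innovArray k τ ω ^ 2 ∂μ ≤ max K 0 + 1 := fun k τ => by
    have h := integral_mono (h2 k τ) ((integrable_const 1).add (h4 k τ)) (hpt k τ)
    simp only [Pi.add_apply] at h
    rw [integral_add (integrable_const 1) (h4 k τ)] at h
    simp only [integral_const, probReal_univ, one_smul] at h
    linarith [h4' k τ]
  have hK0 : 0 ≤ max K 0 := le_max_right _ _
  -- With `u = (c |J|)² (max K 0 + 1)` the choice `Λ = u + 1` is positive and satisfies `u ≤ Λ²`.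
  refine ⟨c, max K 0 + 1, (c * Fintype.card (Fin (L + 1) × Fin d)) ^ 2 * (max K 0 + 1) + 1,
    hM.isIndepField, hc, fun k τ => ?_, h2, h4, h2',
    fun k τ => (h4' k τ).trans (by linarith), by linarith, by positivity, ?_⟩
  · refine (measurable_pi_apply k.2).comp
      (Measurable.mono (comap_measurable (M.innov k.1 τ)) ?_ le_rfl)
    exact le_iSup₂ (f := fun (k : Fin (L + 1) × ℤ)
      (_ : k ∈ {k : Fin (L + 1) × ℤ | k.2 ∈ ({τ} : Set ℤ)}) =>
        MeasurableSpace.comap (M.innov k.1 k.2) inferInstance) (k.1, τ) rfl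
  · have : 0 ≤ (c * Fintype.card (Fin (L + 1) × Fin d)) ^ 2 * (max K 0 + 1) := by positivity
    nlinarith

end ErrorModel

/-! ### Prediction error bounds and consistency -/

theorem regParam_nonneg (C α : ℝ) (T p : ℕ) : 0 ≤ regParam C α T p :=
  mul_nonneg (Real.sqrt_nonneg _) (Real.sqrt_nonneg _)

theorem sq_mul_regParam {C α : ℝ} (hC : 0 ≤ C) (hα : 0 < α) {T : ℕ} (hT : 1 ≤ T) (p : ℕ) :
    (T * regParam C α T p) ^ 2 = C / α * (p * T) := by
  have hT' : (0 : ℝ) < T := by exact_mod_cast hT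
  rw [regParam, mul_pow, mul_pow, Real.sq_sqrt (by positivity), Real.sq_sqrt (by positivity)]
  field_simp

theorem tendstoInMeasure_zero_of_nonneg {Ω : Type*} [MeasurableSpace Ω] {μ : Measure Ω}
    {f : ℕ → Ω → ℝ} (h0 : ∀ n ω, 0 ≤ f n ω)
    (h : ∀ ε : ℝ, 0 < ε → ∀ δ : ℝ, 0 < δ → ∀ᶠ n in atTop, μ {ω | ε ≤ f n ω} ≤ ENNReal.ofReal δ) :
    TendstoInMeasure μ f atTop (fun _ => (0 : ℝ)) := by
  rw [tendstoInMeasure_iff_norm]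
  intro ε hε
  rw [ENNReal.tendsto_nhds_zero]
  intro δ hδ
  rcases eq_or_ne δ ∞ with rfl | hδt
  · exact Eventually.of_forall fun _ => le_top
  filter_upwards [h ε hε δ.toReal (ENNReal.toReal_pos hδ.ne' hδt)] with n hn
  rw [ENNReal.ofReal_toReal hδt] at hn
  simpa only [sub_zero, Real.norm_eq_abs, abs_of_nonneg (h0 n _)] using hn

theorem mainTheorem7 {Ω : Type*} [MeasurableSpace Ω] (μ : Measure Ω) [IsProbabilityMeasure μ]
    {d L m q : ℕ} (M : ErrorModel d L m q Ω) (hM : M.Assumptions μ)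
    (x : ℕ → ℕ → ℝ) (S : Set (ℕ × ℕ)) (hx : RegressorAssumptions x S) (ν : Fin d) :
    ∃ C₀ : ℝ, 0 < C₀ ∧ ∀ Cν : ℝ, C₀ ≤ Cν →
      -- growth of the second moments of the partial sums
      (∀ N j : ℕ, ∫⁻ ω, ‖∑ t ∈ Finset.Icc 1 N, x t j * M.err μ (t : ℤ) ω ν‖ₑ ^ 2 ∂μ
        ≤ ENNReal.ofReal (Cν * N)) ∧
      -- the bound for the sample prediction error
      (∀ α ∈ Set.Ioo (0 : ℝ) 1, ∀ s ∈ Set.Icc (1 : ℝ) 2, ∀ T p : ℕ, (T, p) ∈ S →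
        ∀ (β : Fin p → ℝ) (bhat : Ω → Fin p → ℝ),
          IsPenalizedLSE x T p β (fun t ω => M.err μ t ω ν) (regParam Cν α T p) s bhat →
          μ {ω | ¬ sampleMSPE x T p β (bhat ω) ≤ 2 * regParam Cν α T p * lsNorm s β}
            ≤ ENNReal.ofReal α) ∧
      -- consistency for `p = o(T)` and bounded `‖β‖_s`
      (∀ α ∈ Set.Ioo (0 : ℝ) 1, ∀ s ∈ Set.Icc (1 : ℝ) 2, ∀ T p : ℕ → ℕ,
        (∀ n, (T n, p n) ∈ S) → Tendsto T atTop atTop →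
        ∀ (β : ∀ n, Fin (p n) → ℝ) (bhat : ∀ n, Ω → Fin (p n) → ℝ),
          (∀ n, IsPenalizedLSE x (T n) (p n) (β n) (fun t ω => M.err μ t ω ν)
            (regParam Cν α (T n) (p n)) s (bhat n)) →
          (fun n => (p n : ℝ)) =o[atTop] (fun n => (T n : ℝ)) →
          (fun n => lsNorm s (β n)) =O[atTop] (fun _ => (1 : ℝ)) →
          TendstoInMeasure μ (fun n ω => sampleMSPE x (T n) (p n) (β n) (bhat n ω)) atTop
            (fun _ => (0 : ℝ))) ∧
      -- consistency for unconstrained `T, p → ∞` and sparse `β`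
      (∀ α : ℕ → ℝ, (∀ n, α n ∈ Set.Ioo (0 : ℝ) 1) → ∀ s ∈ Set.Icc (1 : ℝ) 2, ∀ T p : ℕ → ℕ,
        (∀ n, (T n, p n) ∈ S) → Tendsto T atTop atTop → Tendsto p atTop atTop →
        ∀ (β : ∀ n, Fin (p n) → ℝ) (bhat : ∀ n, Ω → Fin (p n) → ℝ),
          (∀ n, IsPenalizedLSE x (T n) (p n) (β n) (fun t ω => M.err μ t ω ν)
            (regParam Cν (α n) (T n) (p n)) s (bhat n)) →
          (fun n => lsNorm s (β n)) =o[atTop] (fun n => (regParam Cν (α n) (T n) (p n))⁻¹) →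
          TendstoInMeasure μ (fun n ω => sampleMSPE x (T n) (p n) (β n) (bhat n ω)) atTop
            (fun _ => (0 : ℝ))) := by
  obtain ⟨c, K, Λ, hP⟩ := hM.isCausalProcess ν
  obtain ⟨B₀, hB₀⟩ := hx.bounded
  obtain ⟨a, b, ha, hspec⟩ := hx.spec
  set B : ℝ := max B₀ 1 with hBdef
  have hB : 0 < B := lt_of_lt_of_le one_pos (le_max_right _ _)
  have hxB : ∀ t j, |x t j| ≤ B := fun t j => (hB₀ t j).trans (le_max_left _ _)
  have hΛ := hP.pos
  set C₁ : ℝ := 144 * B ^ 2 * Λ ^ 2 with hC₁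
  have hC₁0 : 0 < C₁ := by positivity
  let e : ℤ → Ω → ℝ := fun t ω => M.err μ t ω ν
  -- `M.err` is by definition the `centEval` of `M.functional ν` on `M.innovArray`, so the results
  -- on causal processes apply to `e` directly.
  have he : ∀ t, AEMeasurable (e t) μ := fun t => hP.aemeasurable_centEval t
  have hmoment : ∀ N j : ℕ, ∫⁻ ω, ‖score x N (fun t => e t ω) j‖ₑ ^ 2 ∂μ
      ≤ ENNReal.ofReal (C₁ * N) := fun N j => by
    have h := hP.lintegral_sum_centEval_sub_sq_le 0 (fun t => hxB t j) N
    simp only [centTrunc_zero, sub_zero, Nat.cast_zero, zero_add, div_one] at h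
    exact h
  -- Claim (4) needs `4Q ≤ Cν p T` on the event `Q < 8 C₁ p T`, hence `32 C₁`; claim (2) would need
  -- only `4 C₁`.
  refine ⟨32 * C₁, by positivity, fun Cν hCν => ?_⟩
  have hCν0 : 0 < Cν := lt_of_lt_of_le (by positivity) hCν
  refine ⟨fun N j => ?_, ?_, ?_, ?_⟩
  · refine (hmoment N j).trans (ENNReal.ofReal_le_ofReal ?_)
    exact mul_le_mul_of_nonneg_right (by linarith) (Nat.cast_nonneg N)
  · intro α hα s hs T p hTp β bhat hbhat
    obtain ⟨hT, hp⟩ := hx.pos T p hTp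
    have hT' : (0 : ℝ) < T := by exact_mod_cast hT
    have hp' : (0 : ℝ) < p := by exact_mod_cast hp
    have hα0 := hα.1
    -- The bad event is contained in an event about the score alone, so the minimizer `bhat` need
    -- not be measurable in `ω`.
    have hsub : {ω | ¬ sampleMSPE x T p β (bhat ω) ≤ 2 * regParam Cν α T p * lsNorm s β}
        ⊆ {ω | Cν / α * (p * T) / 4 ≤ scoreSq x T p fun t => e t ω} := fun ω hω => by
      by_contra hcon
      refine hω (sampleMSPE_le_of_scoreSq_le hT (regParam_nonneg _ _ _ _) hs (hbhat ω) ?_)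
      rw [sq_mul_regParam hCν0.le hα.1 hT]
      have : scoreSq x T p (fun t => e t ω) < Cν / α * (p * T) / 4 := not_le.1 hcon
      linarith
    refine (measure_mono hsub).trans ((meas_le_scoreSq_le he (hmoment T) p
      (by positivity)).trans (ENNReal.ofReal_le_ofReal ?_))
    have e1 : C₁ * (p * T) / (Cν / α * (p * T) / 4) = α * (4 * C₁ / Cν) := by field_simp
    rw [e1]
    refine mul_le_of_le_one_right hα.1.le ?_
    rw [div_le_one hCν0]
    linarith
  · intro α hα s hs T p hTp _ β bhat hbhat hpT hβ
    refine tendstoInMeasure_zero_of_nonneg (fun n ω => sampleMSPE_nonneg _ _ _ _ _) fun ε hε δ hδ => ?_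
    have hratio : Tendsto (fun n => (p n : ℝ) / T n) atTop (𝓝 0) := hpT.tendsto_div_nhds_zero
    have hlam : Tendsto (fun n => regParam Cν α (T n) (p n)) atTop (𝓝 0) := by
      have := (hratio.sqrt).const_mul (√(Cν / α))
      simpa [regParam] using this
    have hpen : Tendsto (fun n => 2 * regParam Cν α (T n) (p n) * lsNorm s (β n)) atTop (𝓝 0) := by
      have h1 : (fun n => regParam Cν α (T n) (p n)) =o[atTop] (fun _ => (1 : ℝ)) :=
        (Asymptotics.isLittleO_one_iff ℝ).2 hlam
      have h2 := (Asymptotics.isLittleO_one_iff ℝ).1 (by simpa using h1.mul_isBigO hβ)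
      simpa [mul_assoc] using h2.const_mul 2
    have hprob : Tendsto (fun n => 8 * C₁ / (a * ε) * ((p n : ℝ) / T n)) atTop (𝓝 0) := by
      simpa using hratio.const_mul (8 * C₁ / (a * ε))
    filter_upwards [hpen.eventually_lt_const (half_pos hε), hprob.eventually_lt_const hδ]
      with n hn1 hn2
    obtain ⟨hTn, hpn⟩ := hx.pos _ _ (hTp n)
    have hT' : (0 : ℝ) < T n := by exact_mod_cast hTn
    -- Once the penalty term is below `ε/2`, an error of at least `ε` forces `4Q/(aT²) ≥ ε/2`, which
    -- has probability `O(p/T)`.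
    have hsub : {ω | ε ≤ sampleMSPE x (T n) (p n) (β n) (bhat n ω)}
        ⊆ {ω | a * T n ^ 2 * ε / 8 ≤ scoreSq x (T n) (p n) fun t => e t ω} := fun ω hω => by
      have h1 : ε ≤ sampleMSPE x (T n) (p n) (β n) (bhat n ω) := hω
      have h2 := sampleMSPE_le_of_lower_bound hTn (regParam_nonneg _ _ _ _) ha (hbhat n ω)
        (mul_sum_sq_le_sampleMSPE (fun κ hκ => (hspec _ _ (hTp n) hκ).1) _ _)
      have h3 : ε / 2 ≤ 4 * scoreSq x (T n) (p n) (fun t => e t ω) / (a * T n ^ 2) := by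
        linarith
      rw [le_div_iff₀ (by positivity)] at h3
      change a * T n ^ 2 * ε / 8 ≤ scoreSq x (T n) (p n) (fun t => e t ω)
      linarith
    refine (measure_mono hsub).trans ((meas_le_scoreSq_le he (hmoment _) (p n)
      (by positivity)).trans (ENNReal.ofReal_le_ofReal ?_))
    have e1 : C₁ * (p n * T n) / (a * T n ^ 2 * ε / 8)
        = 8 * C₁ / (a * ε) * ((p n : ℝ) / T n) := by field_simp
    rw [e1]
    exact hn2.le
  · intro α hα s hs T p hTp hT hp β bhat hbhat hβ
    refine tendstoInMeasure_zero_of_nonneg (fun n ω => sampleMSPE_nonneg _ _ _ _ _) fun ε hε δ hδ => ?_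
    obtain ⟨n₀, hn₀⟩ := hP.exists_meas_le_scoreSq_le hB hxB b hδ
    filter_upwards [hT.eventually_ge_atTop n₀, hp.eventually_ge_atTop n₀,
      hβ.def (show 0 < ε / 4 by positivity)] with n hnT hnp hnβ
    obtain ⟨hTn, hpn⟩ := hx.pos _ _ (hTp n)
    have hlam := regParam_nonneg Cν (α n) (T n) (p n)
    have hpen : 2 * regParam Cν (α n) (T n) (p n) * lsNorm s (β n) < ε := by
      rw [Real.norm_eq_abs, abs_of_nonneg (lsNorm_nonneg _ _), Real.norm_eq_abs,
        abs_of_nonneg (inv_nonneg.2 hlam)] at hnβ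
      have h1 := mul_le_mul_of_nonneg_left hnβ hlam
      -- The product of the parameter with its inverse is at most one even if the parameter were
      -- zero, so positivity is not needed here.
      have h2 := mul_inv_le_one (a := regParam Cν (α n) (T n) (p n))
      nlinarith
    refine le_trans (measure_mono fun ω hω => ?_) (hn₀ (T n) (p n) hnT hnp hTn hpn fun κ hκ =>
      ⟨ha.le.trans (hspec _ _ (hTp n) hκ).1, (hspec _ _ (hTp n) hκ).2⟩)
    have h1 : ε ≤ sampleMSPE x (T n) (p n) (β n) (bhat n ω) := hω
    by_contra hcon
    have h2 : scoreSq x (T n) (p n) (fun t => e t ω) < 8 * C₁ * (p n * T n) := not_le.1 hcon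
    have h3 := sampleMSPE_le_of_scoreSq_le hTn hlam hs (hbhat n ω) (by
      rw [sq_mul_regParam hCν0.le (hα n).1 hTn]
      -- Only `α n < 1` matters: on the high-probability event the penalty dominates the score for
      -- every level, constant or not.
      have h4 : 32 * C₁ ≤ Cν / α n := by
        refine hCν.trans ?_
        rw [le_div_iff₀ (hα n).1]
        exact mul_le_of_le_one_right hCν0.le (hα n).2.le
      have h5 := mul_le_mul_of_nonneg_right h4
        (by positivity : (0 : ℝ) ≤ (p n : ℝ) * T n)
      change 4 * scoreSq x (T n) (p n) (fun t => e t ω) ≤ _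
      linarith)
    linarith
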